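/- Let $g\ge 4$ and $r\ge 3$ be integers. Let $W\ge 0$ be a real random variable whose law is absolutely continuous with density $f$ and distribution function $F(x)=\mathbb P(W\le x)$, and suppose $\mathbb E[W]<\infty$. For a finite nonempty simple graph $G=(V,E)$ whose nodes carry i.i.d. weights $(W_i)_{i\in V}$ distributed as $W$, let $GREEDY$ be the algorithm that, as long as nodes remain, selects the remaining node of greatest weight, adds it to the independent set, deletes it and all remaining nodes adjacent to it, and repeats; let $\mathcal{IG}$ be the independent set it returns (with probability one it is uniquely determined) and $W[\mathcal{IG}]=\sum_{i\in\mathcal{IG}}W_i$ its weight. Let $G(g,r)$ be the family of all finite nonempty $r$-regular simple graphs in which every cycle has length at least $g$. Then \begin{align*} \int_0^\infty x\big(r-1-(r-2)F(x)\big)^{-\frac{r}{r-2}}f(x)\,dx-\mathbb E[W]\,\frac{r(r-1)^{\lfloor\frac{g-2}{2}\rfloor}}{(\lfloor\frac{g-2}{2}\rfloor+1)!} &\le\inf_{G\in G(g,r)}\mathbb E\left[\frac{W[\mathcal{IG}]}{|V|}\right]\le\sup_{G\in G(g,r)}\mathbb E\left[\frac{W[\mathcal{IG}]}{|V|}\right]\\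 &\le\int_0^\infty x\big(r-1-(r-2)F(x)\big)^{-\frac{r}{r-2}}f(x)\,dx+\mathbb E[W]\,\frac{r(r-1)^{\lfloor\frac{g-2}{2}\rfloor}}{(\lfloor\frac{g-2}{2}\rfloor+1)!}, \end{align*} where all the integrals and expectations involved are finite. -/

import Mathlib

open MeasureTheory
open scoped Nat

universe u v

open Classical in
/-- The greedy algorithm run on the set `R` of remaining nodes of the graph `G` with node
weights `w`: as long as a node remains, select a remaining node of greatest weight, put it in the
output, delete it together with all remaining nodes adjacent to it, and repeat.
(When several remaining nodes have the greatest weight, one of them is picked.) -/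
noncomputable def greedyFrom {V : Type*} (G : SimpleGraph V) (w : V → ℝ) (R : Finset V) :
    Finset V :=
  if h : R.Nonempty then
    insert (R.exists_max_image w h).choose
      (greedyFrom G w
        ((R.erase (R.exists_max_image w h).choose).filter
          fun j => ¬ G.Adj (R.exists_max_image w h).choose j))
  else ∅
termination_by R.card
decreasing_by
  exact lt_of_le_of_lt (Finset.card_filter_le _ _)
    (Finset.card_erase_lt_of_mem (R.exists_max_image w h).choose_spec.1)

/-- The independent set returned by the greedy algorithm on the whole weighted graph. -/
noncomputable def greedySet {V : Type*} [Fintype V] (G : SimpleGraph V) (w : V → ℝ) : Finset V :=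
  greedyFrom G w Finset.univ

/-- The weight of the greedy independent set, divided by the number of nodes. -/
noncomputable def greedyWeightPerNode {V : Type*} [Fintype V] (G : SimpleGraph V)
    (w : V → ℝ) : ℝ :=
  (∑ i ∈ greedySet G w, w i) / (Fintype.card V : ℝ)

/-- The joint law of node weights that are i.i.d. with law `μ`. -/
noncomputable def iidWeights (V : Type*) [Fintype V] (μ : Measure ℝ) : Measure (V → ℝ) :=
  Measure.pi fun _ => μ

/-- The expected weight per node of the greedy independent set, for i.i.d. node weights of
law `μ`. -/
noncomputable def expectedGreedyWeightPerNode {V : Type*} [Fintype V] (G : SimpleGraph V)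
    (μ : Measure ℝ) : ℝ :=
  ∫ w, greedyWeightPerNode G w ∂(iidWeights V μ)

open Classical in
/-- The family of all finite nonempty simple graphs that are `r`-regular and have girth at
least `g`. -/
structure RegularGraphOfGirth (g r : ℕ) : Type (u + 1) where
  /-- The nodes. -/
  V : Type u
  [fintypeV : Fintype V]
  [nonemptyV : Nonempty V]
  /-- The graph. -/
  graph : SimpleGraph V
  regular : graph.IsRegularOfDegree r
  girth_ge : (g : ℕ∞) ≤ graph.egirth

attribute [instance] RegularGraphOfGirth.fintypeV RegularGraphOfGirth.nonemptyV

/-- `x (r - 1 - (r - 2) F(x))^(-r / (r - 2)) f(x)`. -/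
noncomputable def limitIntegrand (r : ℕ) (F f : ℝ → ℝ) (x : ℝ) : ℝ :=
  x * ((r : ℝ) - 1 - ((r : ℝ) - 2) * F x) ^ (-((r : ℝ) / ((r : ℝ) - 2))) * f x

/-- `r (r - 1)^⌊(g - 2) / 2⌋ / (⌊(g - 2) / 2⌋ + 1)!`, for `g ≥ 2`. -/
noncomputable def girthError (g r : ℕ) : ℝ :=
  (r : ℝ) * ((r : ℝ) - 1) ^ ((g - 2) / 2) / (((g - 2) / 2 + 1)! : ℝ)

/-! Almost surely no two weights tie, and then a node is selected iff no heavier neighbour is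
selected. Unrolling this rule to depth d gives `localDecision`, which overestimates membership for
even d and underestimates it for odd d; a wrong answer forces a path with d + 1 edges and increasing
weights (`localDecision_sandwich`). A union bound over the r(r-1)^d possible paths shows that
truncation changes the expected contribution of a node by at most ε = E[W] r(r-1)^d/(d+1)!.

If 2d < g, the branches at a node are disjoint, hence independent, and the truncated rule behaves as
on a tree. There `rejectionProb` iterates T ↦ 1 - ∫_{(x,∞)} T^(r-1) dμ from T_0 = 1, and the root
contributes ∫ y T_d(y)^r dμ (`setIntegral_localDecision_eq`). The substitution t = F(x) turns the
fixed-point equation into q' = q^(r-1), q(1) = 1, solved by `limitRejection`. The map reverses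
order, so T_d lies above the fixed point for even d and below it for odd d, and ∫ y T_d^r is within
the same ε of the limiting integral (`integral_rejectionProb_sandwich`).

Parity avoids a factor 2: the contribution of a node and the limiting integral lie on the same side
of ∫ y T_d^r, both within ε of it, hence within ε of each other. It remains to average over the
nodes with d = ⌊(g-2)/2⌋. The inequality inf ≤ sup also needs a graph in the family; a Cayley graph
supplies it. -/

/-! ### Existence of finite regular graphs of large girth -/

/-- A bounded version of right multiplication by the generator `i` of a free product of copies of
`ℤ/2`, acting on words of length at most `n`. -/
def toggleWord {α : Type*} [DecidableEq α] (n : ℕ) (i : α) : List α → List α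
  | [] => if 0 < n then [i] else []
  | a :: l => if a = i then l else if (a :: l).length < n then i :: a :: l else a :: l

/-- Reduced words of length at most `n`. -/
abbrev ReducedWord (α : Type*) (n : ℕ) := {l : List α // l.length ≤ n ∧ l.IsChain (· ≠ ·)}

theorem toggleWord_mem {α : Type*} [DecidableEq α] (n : ℕ) (i : α) (l : List α)
    (hl : l.length ≤ n ∧ l.IsChain (· ≠ ·)) :
    (toggleWord n i l).length ≤ n ∧ (toggleWord n i l).IsChain (· ≠ ·) := by
  cases l with
  | nil => simp only [toggleWord]; split_ifs <;> simp_all; omega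
  | cons a l =>
    simp only [toggleWord]
    split_ifs with h1 h2
    · exact ⟨by have := hl.1; simp at this; omega, hl.2.tail⟩
    · refine ⟨by simp at h2 ⊢; omega, ?_⟩
      rw [List.isChain_cons_cons]
      exact ⟨fun h => h1 h.symm, hl.2⟩
    · exact hl

/-- In a reduced word the letter after a leading `i` is not `i`, so deleting `i` is undone by
prepending it. Words of full length that do not start with `i` are fixed. -/
theorem toggleWord_toggleWord {α : Type*} [DecidableEq α] (n : ℕ) (i : α) (l : List α)
    (hl : l.length ≤ n ∧ l.IsChain (· ≠ ·)) : toggleWord n i (toggleWord n i l) = l := by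
  cases l with
  | nil => simp only [toggleWord]; split_ifs <;> simp_all
  | cons a l =>
    by_cases h1 : a = i
    · subst h1
      cases l with
      | nil => have := hl.1; simp [toggleWord] at *; omega
      | cons b l =>
        have h2 := hl.2
        rw [List.isChain_cons_cons] at h2
        have := hl.1
        simp only [List.length_cons] at this
        simp [toggleWord, h2.1.symm]
        omega
    · by_cases h2 : (a :: l).length < n
      · simp only [List.length_cons] at h2
        simp [toggleWord, h1, h2]
      · simp only [List.length_cons] at h2
        simp [toggleWord, h1, h2]

/-- The involution of the reduced words of length at most `n` given by the generator `i`. -/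
def togglePerm {α : Type*} [DecidableEq α] (n : ℕ) (i : α) : Equiv.Perm (ReducedWord α n) where
  toFun l := ⟨toggleWord n i l.1, toggleWord_mem n i l.1 l.2⟩
  invFun l := ⟨toggleWord n i l.1, toggleWord_mem n i l.1 l.2⟩
  left_inv l := Subtype.ext (toggleWord_toggleWord n i l.1 l.2)
  right_inv l := Subtype.ext (toggleWord_toggleWord n i l.1 l.2)

theorem togglePerm_mul_self {α : Type*} [DecidableEq α] (n : ℕ) (i : α) :
    togglePerm n i * togglePerm n i = 1 :=
  Equiv.ext fun l => Subtype.ext (toggleWord_toggleWord n i l.1 l.2)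

/-- Acting on the empty word, the product spells `l` letter by letter from its right end. Hence no
nonempty reduced word of length at most `n` is a relation between the involutions. -/
theorem prod_togglePerm_nil {α : Type*} [DecidableEq α] (n : ℕ) (l : List α)
    (hl : l.length ≤ n ∧ l.IsChain (· ≠ ·)) :
    (l.map (togglePerm n)).prod ⟨[], by simp⟩ = ⟨l, hl⟩ := by
  induction l with
  | nil => rfl
  | cons a l ih =>
    have hl' : l.length ≤ n ∧ l.IsChain (· ≠ ·) :=
      ⟨by have := hl.1; simp at this; omega, hl.2.tail⟩
    rw [List.map_cons, List.prod_cons, Equiv.Perm.mul_apply, ih hl']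
    apply Subtype.ext
    change toggleWord n a l = a :: l
    have h1 := hl.1
    cases l with
    | nil => simp at h1; simp [toggleWord]; omega
    | cons b l =>
      have h2 := hl.2
      rw [List.isChain_cons_cons] at h2
      simp only [List.length_cons] at h1
      simp [toggleWord, h2.1.symm]
      omega

theorem togglePerm_injective {α : Type*} [DecidableEq α] {n : ℕ} (hn : 1 ≤ n) :
    Function.Injective (togglePerm (α := α) n) := by
  intro i j h
  have hi := prod_togglePerm_nil n [i] ⟨by simpa, by simp⟩
  have hj := prod_togglePerm_nil n [j] ⟨by simpa, by simp⟩
  simp only [List.map_cons, List.map_nil, List.prod_cons, List.prod_nil, mul_one, h] at hi hj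
  simpa using hi.symm.trans hj

theorem togglePerm_ne_one {α : Type*} [DecidableEq α] {n : ℕ} (hn : 1 ≤ n) (i : α) :
    togglePerm n i ≠ 1 := by
  intro h
  have hi := prod_togglePerm_nil n [i] ⟨by simpa, by simp⟩
  simp [h] at hi

/-- The Cayley graph of the permutations of the reduced words of length at most `n`, with respect
to the involutions `togglePerm n i`. -/
def toggleGraph (α : Type*) [DecidableEq α] (n : ℕ) (hn : 1 ≤ n) :
    SimpleGraph (Equiv.Perm (ReducedWord α n)) where
  Adj x y := ∃ i, y = togglePerm n i * x
  symm := ⟨by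
    rintro x y ⟨i, rfl⟩
    exact ⟨i, by rw [← mul_assoc, togglePerm_mul_self, one_mul]⟩⟩
  loopless := ⟨by
    rintro x ⟨i, h⟩
    exact togglePerm_ne_one hn i (by simpa using h.symm)⟩

/-- The word lists the generators used, the last step leftmost. Two equal adjacent letters would
mean walking back along the same edge, which a trail cannot do; the clause on `getLast?` remembers
the first edge so that the induction can see this. -/
theorem exists_word_of_walk {α : Type*} [DecidableEq α] {n : ℕ} {hn : 1 ≤ n}
    {x y : Equiv.Perm (ReducedWord α n)} (p : (toggleGraph α n hn).Walk x y)
    (hp : p.edges.Nodup) :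
    ∃ l : List α, l.length = p.length ∧ l.IsChain (· ≠ ·) ∧ y = (l.map (togglePerm n)).prod * x ∧
      ∀ i ∈ l.getLast?, s(x, togglePerm n i * x) ∈ p.edges := by
  induction p with
  | nil => exact ⟨[], by simp⟩
  | @cons x z y h p ih =>
    rw [SimpleGraph.Walk.edges_cons, List.nodup_cons] at hp
    obtain ⟨l, hl, hc, hy, he⟩ := ih hp.2
    have hz : ∃ i, z = togglePerm n i * x := h
    obtain ⟨i, hi⟩ := hz
    refine ⟨l ++ [i], by simp [hl], ?_, by simp [hy, hi, mul_assoc], ?_⟩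
    · rw [List.isChain_append]
      refine ⟨hc, by simp, ?_⟩
      rintro a ha b hb hab
      simp at hb
      subst hb
      subst hab
      have h1 : togglePerm n a * z = x := by
        rw [hi, ← mul_assoc, togglePerm_mul_self, one_mul]
      have h2 := he _ ha
      rw [h1, Sym2.eq_swap] at h2
      exact hp.1 h2
    · rintro j hj
      simp only [List.getLast?_append, List.getLast?_singleton, Option.some_or, Option.mem_some_iff] at hj
      rw [← hj, ← hi, SimpleGraph.Walk.edges_cons]
      exact List.mem_cons_self

/-- A cycle spells a nonempty reduced word whose product is 1, and such a word is longer than `n`.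
-/
theorem toggleGraph_le_egirth (α : Type*) [DecidableEq α] (n : ℕ) (hn : 1 ≤ n) :
    ((n + 1 : ℕ) : ℕ∞) ≤ (toggleGraph α n hn).egirth := by
  rw [SimpleGraph.le_egirth]
  intro a c hc
  by_contra hlt
  have hlt : c.length < n + 1 := by exact_mod_cast not_le.1 hlt
  obtain ⟨l, hl, hch, hy, -⟩ := exists_word_of_walk c hc.edges_nodup
  have h1 : (l.map (togglePerm n)).prod = 1 := by simpa using hy.symm
  have h2 := prod_togglePerm_nil n l ⟨by omega, hch⟩
  rw [h1] at h2
  have h3 : l = [] := by simpa using (congrArg Subtype.val h2).symm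
  have := hc.three_le_length
  simp [h3] at hl
  omega

instance (α : Type*) [Fintype α] (n : ℕ) : Finite (ReducedWord α n) :=
  ((List.finite_length_le α n).subset fun _ hl => hl.1).to_subtype

theorem nonempty_regularGraphOfGirth (g r : ℕ) : Nonempty (RegularGraphOfGirth.{u} g r) := by
  classical
  -- Any `n` with `1 ≤ n` and `g ≤ n + 1` would do; `1 ≤ n` makes the generators distinct and
  -- nontrivial.
  let n := g + 1
  let V := ULift.{u} (Equiv.Perm (ReducedWord (Fin r) n))
  have hn : 1 ≤ n := by omega
  have : Finite V := inferInstance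
  let e : V ≃ Equiv.Perm (ReducedWord (Fin r) n) := Equiv.ulift
  let G : SimpleGraph V := (toggleGraph (Fin r) n hn).comap e
  let _ : Fintype V := Fintype.ofFinite V
  refine ⟨⟨V, G, ?_, ?_⟩⟩
  · intro x
    have : G.neighborFinset x =
        Finset.univ.image fun i : Fin r => e.symm (togglePerm n i * e x) := by
      ext y
      simp only [SimpleGraph.mem_neighborFinset, Finset.mem_image, Finset.mem_univ, true_and]
      constructor
      · rintro ⟨i, hi⟩
        exact ⟨i, by rw [← hi, e.symm_apply_apply]⟩
      · rintro ⟨i, rfl⟩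
        exact ⟨i, by simp⟩
    rw [← SimpleGraph.card_neighborFinset_eq_degree]
    convert (congrArg Finset.card this).trans ?_
    rw [Finset.card_image_of_injective]
    · simp
    · intro i j h
      have h := e.symm.injective h
      exact togglePerm_injective hn (mul_right_cancel h)
  · let ψ : G ≃g toggleGraph (Fin r) n hn := ⟨e, by intro a b; rfl⟩
    rw [SimpleGraph.le_egirth]
    intro a c hc
    have h1 := (SimpleGraph.le_egirth.1 (toggleGraph_le_egirth (Fin r) n hn)) _
      (c.map ψ.toHom) (hc.map ψ.injective)
    rw [SimpleGraph.Walk.length_map] at h1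
    refine le_trans ?_ h1
    exact_mod_cast (by omega : g ≤ n + 1)

/-! ### The greedy set as solution of a local recursion -/

theorem greedyFrom_subset {V : Type*} (G : SimpleGraph V) (w : V → ℝ) (R : Finset V) :
    greedyFrom G w R ⊆ R := by
  classical
  induction R using Finset.strongInduction with
  | H R ih =>
    rw [greedyFrom]
    split_ifs with h
    · have hm := (R.exists_max_image w h).choose_spec.1
      refine Finset.insert_subset hm ((ih _ ?_).trans ?_)
      · exact Finset.ssubset_of_subset_of_ssubset (Finset.filter_subset _ _)
          (Finset.erase_ssubset hm)
      · exact (Finset.filter_subset _ _).trans (Finset.erase_subset _ _)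
    · simp

/-- Let `m` be the node selected now. Either `v = m` and nothing is heavier; or `v` is adjacent to
`m`, a heavier selected node; or `v` survives the round, and none of its neighbours deleted in this
round is selected, since `m` is not a neighbour of `v`. -/
theorem mem_greedyFrom_iff {V : Type*} (G : SimpleGraph V) {w : V → ℝ}
    (hw : Function.Injective w) (R : Finset V) {v : V} (hv : v ∈ R) :
    v ∈ greedyFrom G w R ↔
      ∀ u ∈ R, G.Adj v u → w v < w u → u ∉ greedyFrom G w R := by
  classical
  induction R using Finset.strongInduction generalizing v with
  | H R ih =>
    have h : R.Nonempty := ⟨v, hv⟩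
    rw [greedyFrom, dif_pos h]
    obtain ⟨hm, hmax⟩ := (R.exists_max_image w h).choose_spec
    set m := (R.exists_max_image w h).choose
    have hlt : ∀ u ∈ R, u ≠ m → w u < w m := fun u hu hum =>
      lt_of_le_of_ne (hmax u hu) fun h => hum (hw h)
    set R' := (R.erase m).filter fun j => ¬ G.Adj m j with hR'
    have hmem : ∀ u, u ∈ R' ↔ (u ≠ m ∧ u ∈ R) ∧ ¬ G.Adj m u := by
      intro u; rw [hR', Finset.mem_filter, Finset.mem_erase]
    have hss : R' ⊂ R := Finset.ssubset_of_subset_of_ssubset (Finset.filter_subset _ _)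
      (Finset.erase_ssubset hm)
    have hsub := greedyFrom_subset G w R'
    simp only [Finset.mem_insert]
    by_cases hvm : v = m
    · refine ⟨fun _ u hu _ hlt' => absurd (hmax u hu) (by rw [← hvm]; exact not_le.2 hlt'),
        fun _ => Or.inl hvm⟩
    by_cases hadj : G.Adj m v
    · refine ⟨fun h' => ?_, fun h' => ?_⟩
      · rcases h' with h' | h'
        · exact absurd h' hvm
        · exact absurd hadj ((hmem v).1 (hsub h')).2
      · exact absurd (Or.inl rfl) (h' m hm hadj.symm (hlt v hv hvm))
    · have hvR' : v ∈ R' := (hmem v).2 ⟨⟨hvm, hv⟩, hadj⟩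
      rw [or_iff_right hvm, ih R' hss hvR']
      refine ⟨fun h' u hu huv hlt' => ?_, fun h' u hu huv hlt' hmem' =>
        h' u (hss.1 hu) huv hlt' (Or.inr hmem')⟩
      rintro (rfl | hu')
      · exact hadj huv.symm
      · exact h' u (hsub hu') huv hlt' hu'

theorem mem_greedySet_iff {V : Type*} [Fintype V] (G : SimpleGraph V) {w : V → ℝ}
    (hw : Function.Injective w) (v : V) :
    v ∈ greedySet G w ↔ ∀ u, G.Adj v u → w v < w u → u ∉ greedySet G w := by
  rw [greedySet, mem_greedyFrom_iff G hw _ (Finset.mem_univ v)]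
  simp

/-- The decision on the node `v` that the greedy rule takes when it looks at nodes up to
distance `d` from `v` only and ignores the node `p`. -/
def localDecision {V : Type*} (G : SimpleGraph V) (w : V → ℝ) : ℕ → V → V → Prop
  | 0, _, _ => True
  | d + 1, p, v => ∀ u, G.Adj v u → u ≠ p → w v < w u → ¬ localDecision G w d v u

/-- There is a path with `d` edges and increasing weights that starts in `v`, and does not step
to `p` first. -/
def HasIncreasingPath {V : Type*} (G : SimpleGraph V) (w : V → ℝ) : ℕ → V → V → Prop
  | 0, _, _ => True
  | d + 1, p, v => ∃ u, G.Adj v u ∧ u ≠ p ∧ w v < w u ∧ HasIncreasingPath G w d v u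

/-- Each level of the recursion negates the previous one, so the side of the error alternates,
starting from the overestimate `True`. A wrong decision at `v` must come from a wrong decision at a
heavier neighbour, which prolongs the increasing path. Since `w p ≤ w v`, heavier neighbours are
never `p`, so ignoring `p` costs nothing; at a root one takes `p = v`. -/
theorem localDecision_sandwich {V : Type*} (G : SimpleGraph V) (w : V → ℝ) (S : Finset V)
    (hS : ∀ v, v ∈ S ↔ ∀ u, G.Adj v u → w v < w u → u ∉ S) (d : ℕ) (p v : V)
    (hpv : w p ≤ w v) :
    (Even d → v ∈ S → localDecision G w d p v) ∧
    (Odd d → localDecision G w d p v → v ∈ S) ∧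
    ((v ∈ S ↔ localDecision G w d p v) ∨ HasIncreasingPath G w (d + 1) p v) := by
  have hne : ∀ {p v : V}, w p ≤ w v → ∀ u, w v < w u → u ≠ p := by
    rintro p v hpv u hu rfl
    exact absurd hpv (not_le.2 hu)
  induction d generalizing p v with
  | zero =>
    refine ⟨fun _ _ => trivial, fun h => by simp at h, ?_⟩
    by_cases hv : v ∈ S
    · exact Or.inl ⟨fun _ => trivial, fun _ => hv⟩
    · right
      rw [hS] at hv
      push Not at hv
      obtain ⟨u, hu, hlt, -⟩ := hv
      exact ⟨u, hu, hne hpv u hlt, hlt, trivial⟩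
  | succ d ih =>
    refine ⟨fun he hv u hu _ hlt hd => ?_, fun ho hv => ?_, ?_⟩
    · have ho : Odd d := by rwa [Nat.even_add_one, Nat.not_even_iff_odd] at he
      exact (hS v).1 hv u hu hlt ((ih v u hlt.le).2.1 ho hd)
    · have he : Even d := by rwa [Nat.odd_add_one, Nat.not_odd_iff_even] at ho
      exact (hS v).2 fun u hu hlt hm =>
        hv u hu (hne hpv u hlt) hlt ((ih v u hlt.le).1 he hm)
    · by_cases hp : ∃ u, G.Adj v u ∧ w v < w u ∧ HasIncreasingPath G w (d + 1) v u
      · obtain ⟨u, hu, hlt, h⟩ := hp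
        exact Or.inr ⟨u, hu, hne hpv u hlt, hlt, h⟩
      · left
        push Not at hp
        rw [hS]
        refine forall_congr' fun u => ⟨fun h hu _ hlt => ?_, fun h hu hlt => ?_⟩
        · rw [← (ih v u hlt.le).2.2.resolve_right (hp u hu hlt)]
          exact h hu hlt
        · rw [(ih v u hlt.le).2.2.resolve_right (hp u hu hlt)]
          exact h hu (hne hpv u hlt) hlt

/-- At each step of the path the set of nodes at least as heavy as the current one shrinks strictly.
Hence the recursion to depth `Fintype.card V` is exact. -/
theorem HasIncreasingPath.lt_card {V : Type*} [Fintype V] {G : SimpleGraph V} {w : V → ℝ} {d : ℕ}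
    {p v : V} (h : HasIncreasingPath G w d p v) : d < Fintype.card V := by
  classical
  suffices d < (Finset.univ.filter fun u => w v ≤ w u).card from
    this.trans_le (Finset.card_le_univ _)
  induction d generalizing p v with
  | zero => exact Finset.card_pos.2 ⟨v, by simp⟩
  | succ d ih =>
    obtain ⟨u, -, -, hlt, h⟩ := h
    refine lt_of_le_of_lt (Nat.succ_le_of_lt (ih h)) (Finset.card_lt_card ?_)
    refine (Finset.ssubset_iff_of_subset fun x hx => ?_).2 ⟨v, by simp, by simpa using hlt⟩
    simp only [Finset.mem_filter, Finset.mem_univ, true_and] at hx ⊢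
    exact hlt.le.trans hx

/-! ### Locality: disjoint branches in a graph of large girth -/

/-- The nodes that can be reached from `v` by a path with at most `d + 1` edges that steps to `u`
first. -/
def branch {V : Type*} (G : SimpleGraph V) (d : ℕ) (v u : V) : Set V :=
  {x | ∃ (h : G.Adj v u) (p : G.Walk u x), (SimpleGraph.Walk.cons h p).IsPath ∧ p.length ≤ d}

theorem mem_branch_self {V : Type*} {G : SimpleGraph V} (d : ℕ) {v u : V} (h : G.Adj v u) :
    u ∈ branch G d v u :=
  ⟨h, .nil, by simpa using h.ne, by simp⟩

theorem notMem_branch {V : Type*} {G : SimpleGraph V} (d : ℕ) (v u : V) :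
    v ∉ branch G d v u := by
  rintro ⟨h, p, hp, -⟩
  rw [SimpleGraph.Walk.cons_isPath_iff] at hp
  exact hp.2 p.end_mem_support

/-- If a path through `u` and `t` came back to `v`, the edge `vu` would close it to a cycle of
length at most `d + 2`. -/
theorem branch_subset_branch {V : Type*} {G : SimpleGraph V} {g d : ℕ} (hg : (g : ℕ∞) ≤ G.egirth)
    (hd : d + 2 < g) {v u t : V} (hvu : G.Adj v u) (ht : t ≠ v) :
    branch G d u t ⊆ branch G (d + 1) v u := by
  classical
  rintro x ⟨h, p, hp, hl⟩
  refine ⟨hvu, .cons h p, ?_, by simpa using hl⟩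
  rw [SimpleGraph.Walk.cons_isPath_iff]
  refine ⟨hp, fun hv => ?_⟩
  have hc : (SimpleGraph.Walk.cons hvu ((SimpleGraph.Walk.cons h p).takeUntil v hv)).IsCycle := by
    rw [SimpleGraph.Walk.cons_isCycle_iff]
    refine ⟨hp.takeUntil hv, fun he => ?_⟩
    have he := SimpleGraph.Walk.edges_takeUntil_subset_edges _ _ he
    rw [SimpleGraph.Walk.edges_cons, List.mem_cons] at he
    rcases he with he | he
    · rw [Sym2.eq_swap, Sym2.congr_right] at he
      exact ht he.symm
    · rw [SimpleGraph.Walk.cons_isPath_iff] at hp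
      exact hp.2 (p.snd_mem_support_of_mem_edges he)
  have h1 := SimpleGraph.le_egirth.1 hg _ _ hc
  have h2 := SimpleGraph.Walk.length_takeUntil_le_length (.cons h p) hv
  rw [SimpleGraph.Walk.length_cons] at h1 h2
  have h3 : g ≤ ((SimpleGraph.Walk.cons h p).takeUntil v hv).length + 1 := by exact_mod_cast h1
  omega

/-- Paths in a forest are unique, so the edges of two different paths with the same ends contain a
cycle, which has at most `p.length + q.length` edges. -/
theorem SimpleGraph.Walk.IsPath.eq_of_length_add_lt {V : Type*} {G : SimpleGraph V} {g : ℕ}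
    (hg : (g : ℕ∞) ≤ G.egirth) {v x : V} {p q : G.Walk v x} (hp : p.IsPath) (hq : q.IsPath)
    (hl : p.length + q.length < g) : p = q := by
  classical
  by_contra hne
  let H : SimpleGraph V := SimpleGraph.fromEdgeSet {e | e ∈ p.edges ∨ e ∈ q.edges}
  have hHe : ∀ e ∈ H.edgeSet, e ∈ p.edges ∨ e ∈ q.edges := by
    intro e he
    rw [SimpleGraph.edgeSet_fromEdgeSet] at he
    exact he.1
  have hHG : H ≤ G := by
    rw [← SimpleGraph.edgeSet_subset_edgeSet]
    intro e he
    rcases hHe e he with h | h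
    · exact p.edges_subset_edgeSet h
    · exact q.edges_subset_edgeSet h
  have hpH : ∀ e ∈ p.edges, e ∈ H.edgeSet := fun e he => by
    rw [SimpleGraph.edgeSet_fromEdgeSet]
    exact ⟨Or.inl he, G.not_isDiag_of_mem_edgeSet (p.edges_subset_edgeSet he)⟩
  have hqH : ∀ e ∈ q.edges, e ∈ H.edgeSet := fun e he => by
    rw [SimpleGraph.edgeSet_fromEdgeSet]
    exact ⟨Or.inr he, G.not_isDiag_of_mem_edgeSet (q.edges_subset_edgeSet he)⟩
  have hH : ¬ H.IsAcyclic := by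
    intro hH
    have h1 := (hH.subsingleton_path _ _).elim ⟨p.transfer H hpH, hp.transfer hpH⟩
      ⟨q.transfer H hqH, hq.transfer hqH⟩
    have h2 : p.transfer H hpH = q.transfer H hqH := congrArg Subtype.val h1
    apply hne
    apply SimpleGraph.Walk.ext_support
    rw [← p.support_transfer hpH, ← q.support_transfer hqH, h2]
  rw [SimpleGraph.IsAcyclic] at hH
  push Not at hH
  obtain ⟨y, c, hc⟩ := hH
  have h1 := SimpleGraph.le_egirth.1 hg _ _ (hc.mapLe hHG)
  have h2 : c.length ≤ p.length + q.length := by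
    rw [← c.length_edges, ← p.length_edges, ← q.length_edges, ← List.length_append,
      ← List.toFinset_card_of_nodup hc.edges_nodup]
    refine (Finset.card_le_card fun e he => ?_).trans (List.toFinset_card_le _)
    rw [List.mem_toFinset] at he ⊢
    exact List.mem_append.2 (hHe e (c.edges_subset_edgeSet he))
  have h3 : g ≤ c.length := by simpa using h1
  omega

theorem disjoint_branch {V : Type*} {G : SimpleGraph V} {g d : ℕ} (hg : (g : ℕ∞) ≤ G.egirth)
    (hd : 2 * (d + 1) < g) {v s t : V} (hst : s ≠ t) :
    Disjoint (branch G d v s) (branch G d v t) := by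
  rw [Set.disjoint_left]
  rintro x ⟨hs, p, hp, hpl⟩ ⟨ht, q, hq, hql⟩
  have := SimpleGraph.Walk.IsPath.eq_of_length_add_lt hg hp hq (by simp; omega)
  have h2 := congrArg (·.snd) this
  simp at h2
  exact hst h2

theorem localDecision_congr {V : Type*} {G : SimpleGraph V} {g : ℕ} (hg : (g : ℕ∞) ≤ G.egirth)
    (d : ℕ) (hd : d + 1 < g) {p v : V} (hpv : G.Adj p v) {w w' : V → ℝ}
    (hw : ∀ x ∈ branch G d p v, w x = w' x) :
    localDecision G w d p v ↔ localDecision G w' d p v := by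
  induction d generalizing p v with
  | zero => rfl
  | succ d ih =>
    refine forall_congr' fun u => forall_congr' fun hu => forall_congr' fun hup => ?_
    have hsub := branch_subset_branch hg hd hpv hup
    rw [hw v (mem_branch_self _ hpv), hw u (hsub (mem_branch_self _ hu)),
      ih (by omega) hu fun x hx => hw x (hsub hx)]

theorem hasIncreasingPath_congr {V : Type*} {G : SimpleGraph V} {g : ℕ}
    (hg : (g : ℕ∞) ≤ G.egirth) (d : ℕ) (hd : d + 1 < g) {p v : V} (hpv : G.Adj p v) {w w' : V → ℝ}
    (hw : ∀ x ∈ branch G d p v, w x = w' x) :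
    HasIncreasingPath G w d p v ↔ HasIncreasingPath G w' d p v := by
  induction d generalizing p v with
  | zero => rfl
  | succ d ih =>
    refine exists_congr fun u => and_congr_right fun hu => and_congr_right fun hup => ?_
    have hsub := branch_subset_branch hg hd hpv hup
    rw [hw v (mem_branch_self _ hpv), hw u (hsub (mem_branch_self _ hu)),
      ih (by omega) hu fun x hx => hw x (hsub hx)]

/-! ### The distribution function of an atomless law -/

open ProbabilityTheory Filter Topology Set in
theorem continuous_cdf (μ : Measure ℝ) [IsProbabilityMeasure μ] [NullSingletonClass μ] :
    Continuous (cdf μ) := by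
  rw [continuous_iff_continuousAt]
  intro a
  rw [(monotone_cdf μ).continuousAt_iff_leftLim_eq_rightLim, StieltjesFunction.rightLim_eq]
  refine le_antisymm ((monotone_cdf μ).leftLim_le le_rfl) ?_
  have h : (cdf μ).measure {a} = 0 := by rw [measure_cdf]; exact measure_singleton a
  rw [StieltjesFunction.measure_singleton, ENNReal.ofReal_eq_zero] at h
  linarith

open ProbabilityTheory Filter Topology Set in
/-- The probability integral transform. -/
theorem map_cdf_eq_volume_restrict (μ : Measure ℝ) [IsProbabilityMeasure μ] [NullSingletonClass μ] :
    μ.map (cdf μ) = volume.restrict (Icc 0 1) := by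
  have hc := continuous_cdf μ
  refine Measure.ext_of_Iic _ _ fun t => ?_
  rw [Measure.map_apply hc.measurable measurableSet_Iic, Measure.restrict_apply measurableSet_Iic]
  have hI : Iic t ∩ Icc (0 : ℝ) 1 = Icc 0 (min t 1) := by
    ext y; simp only [mem_inter_iff, mem_Iic, mem_Icc, le_min_iff]; tauto
  rw [hI, Real.volume_Icc, sub_zero]
  rcases lt_or_ge t 1 with ht1 | ht1
  · rw [min_eq_left ht1.le]
    by_cases hne : ∃ z, cdf μ z ≤ t
    · set A := cdf μ ⁻¹' Iic t with hA
      have hAne : A.Nonempty := hne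
      have hAc : IsClosed A := isClosed_Iic.preimage hc
      obtain ⟨b, hb⟩ := ((tendsto_cdf_atTop μ).eventually_const_lt ht1).exists
      have hAb : ∀ y ∈ A, y ≤ b := fun y hy => by
        by_contra hby
        exact absurd ((monotone_cdf μ (not_le.1 hby).le).trans hy) (not_le.2 hb)
      have hbdd : BddAbove A := ⟨b, hAb⟩
      have hs := hAc.csSup_mem hAne hbdd
      have hAI : A = Iic (sSup A) := by
        ext y
        exact ⟨fun hy => le_csSup hbdd hy, fun hy => (monotone_cdf μ hy).trans hs⟩
      -- Were the value smaller than `t`, the intermediate value theorem would give a point of `A`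
      -- beyond `sSup A` at level `t`.
      have hs2 : cdf μ (sSup A) = t := by
        refine le_antisymm hs ?_
        by_contra hlt
        obtain ⟨z, hz, hzt⟩ := intermediate_value_Icc (hAb _ hs) hc.continuousOn
          ⟨(not_le.1 hlt).le, hb.le⟩
        have hzA : z ∈ A := hzt.le
        have : z = sSup A := le_antisymm (le_csSup hbdd hzA) hz.1
        rw [this] at hzt
        exact hlt hzt.ge
      rw [hAI, ← ofReal_cdf, hs2]
    · push Not at hne
      have ht : t ≤ 0 := ge_of_tendsto (tendsto_cdf_atBot μ) (Eventually.of_forall fun z => (hne z).le)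
      rw [ENNReal.ofReal_eq_zero.2 ht]
      have : cdf μ ⁻¹' Iic t = ∅ := by
        ext y; simpa using hne y
      rw [this, measure_empty]
  · rw [min_eq_right ht1]
    have : cdf μ ⁻¹' Iic t = univ := by
      ext y; simpa using (cdf_le_one μ y).trans ht1
    rw [this, measure_univ, ENNReal.ofReal_one]

-- The substitution s = F(y). The events y > x and F(y) > F(x) differ only inside the level set of F
-- at F(x), which is null because F(y) is uniform.
open ProbabilityTheory Filter Topology Set in
theorem setIntegral_Ioi_comp_cdf (μ : Measure ℝ) [IsProbabilityMeasure μ] [NullSingletonClass μ] {h : ℝ → ℝ}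
    (hh : Measurable h) (x : ℝ) : ∫ y in Ioi x, h (cdf μ y) ∂μ = ∫ s in (cdf μ x)..1, h s := by
  have hc := continuous_cdf μ
  have hnull : ∀ᵐ y ∂μ, cdf μ y ≠ cdf μ x := by
    have h0 : μ.map (cdf μ) {cdf μ x} = 0 := by
      rw [map_cdf_eq_volume_restrict]; exact measure_singleton _
    rw [Measure.map_apply hc.measurable (measurableSet_singleton _)] at h0
    exact measure_eq_zero_iff_ae_notMem.1 h0
  have hae : (Ioi x).indicator (fun y => h (cdf μ y)) =ᵐ[μ]
      fun y => (Ioi (cdf μ x)).indicator h (cdf μ y) := by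
    filter_upwards [hnull] with y hy
    by_cases hxy : x < y
    · rw [indicator_of_mem (show y ∈ Ioi x from hxy), indicator_of_mem]
      exact lt_of_le_of_ne (monotone_cdf μ hxy.le) hy.symm
    · rw [indicator_of_notMem (show y ∉ Ioi x from hxy), indicator_of_notMem]
      exact not_lt.2 (monotone_cdf μ (not_lt.1 hxy))
  have hm : Measurable ((Ioi (cdf μ x)).indicator h) := hh.indicator measurableSet_Ioi
  rw [← integral_indicator measurableSet_Ioi, integral_congr_ae hae,
    ← integral_map hc.aemeasurable hm.aestronglyMeasurable, map_cdf_eq_volume_restrict,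
    integral_indicator measurableSet_Ioi, Measure.restrict_restrict measurableSet_Ioi,
    intervalIntegral.integral_of_le (cdf_le_one μ x)]
  congr 2
  ext y
  simp only [mem_inter_iff, mem_Ioi, mem_Icc, mem_Ioc]
  have := cdf_nonneg μ x
  exact ⟨fun h => ⟨h.1, h.2.2⟩, fun h => ⟨h.1, by linarith [h.1], h.2⟩⟩

open ProbabilityTheory in
theorem setIntegral_Ioi_one_sub_cdf_pow (μ : Measure ℝ) [IsProbabilityMeasure μ] [NullSingletonClass μ]
    (n : ℕ) (x : ℝ) :
    ∫ y in Set.Ioi x, (1 - cdf μ y) ^ n ∂μ = (1 - cdf μ x) ^ (n + 1) / (n + 1) := by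
  rw [setIntegral_Ioi_comp_cdf μ (h := fun s => (1 - s) ^ n) (by fun_prop),
    intervalIntegral.integral_comp_sub_left (fun s => s ^ n), integral_pow]
  simp

open ProbabilityTheory in
theorem measureReal_Ioi_eq_one_sub_cdf (μ : Measure ℝ) [IsProbabilityMeasure μ] (x : ℝ) :
    μ.real (Set.Ioi x) = 1 - cdf μ x := by
  rw [cdf_eq_real, ← Set.compl_Iic, probReal_compl_eq_one_sub measurableSet_Iic]

/-! ### The recursion on the tree and its fixed point -/

/-- The probability that the root of a tree in which each node has `n` children does not both
have weight more than `x` and be selected by the greedy rule truncated at depth `d - 1`. -/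
noncomputable def rejectionProb (μ : Measure ℝ) (n : ℕ) : ℕ → ℝ → ℝ
  | 0, _ => 1
  | d + 1, x => 1 - ∫ y in Set.Ioi x, rejectionProb μ n d y ^ n ∂μ

theorem integrable_of_measurable_of_mem_Icc {μ : Measure ℝ} [IsFiniteMeasure μ] {h : ℝ → ℝ}
    (hm : Measurable h) (h01 : ∀ x, h x ∈ Set.Icc (0 : ℝ) 1) : Integrable h μ :=
  Integrable.of_bound hm.aestronglyMeasurable 1
    (Filter.Eventually.of_forall fun x => by
      rw [Real.norm_eq_abs, abs_of_nonneg (h01 x).1]; exact (h01 x).2)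

theorem rejectionProb_mem_Icc_and_measurable (μ : Measure ℝ) [IsProbabilityMeasure μ] (n d : ℕ) :
    (∀ x, rejectionProb μ n d x ∈ Set.Icc (0 : ℝ) 1) ∧ Measurable (rejectionProb μ n d) := by
  induction d with
  | zero => exact ⟨fun x => by simp [rejectionProb], measurable_const⟩
  | succ d ih =>
    have h01 : ∀ y, rejectionProb μ n d y ^ n ∈ Set.Icc (0 : ℝ) 1 := fun y =>
      ⟨pow_nonneg (ih.1 y).1 _, pow_le_one₀ (ih.1 y).1 (ih.1 y).2⟩
    have hint : Integrable (fun y => rejectionProb μ n d y ^ n) μ :=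
      integrable_of_measurable_of_mem_Icc (ih.2.pow_const n) h01
    have hnn : ∀ x, 0 ≤ ∫ y in Set.Ioi x, rejectionProb μ n d y ^ n ∂μ := fun x =>
      integral_nonneg fun y => (h01 y).1
    -- The integral over (x, ∞) of a nonnegative function decreases in x, so measurability comes
    -- from monotonicity.
    refine ⟨fun x => ?_, Monotone.measurable fun x y hxy => ?_⟩
    · have h1 : ∫ y in Set.Ioi x, rejectionProb μ n d y ^ n ∂μ ≤ ∫ y in Set.Ioi x, (1 : ℝ) ∂μ :=
        integral_mono hint.integrableOn (integrable_const _) fun y => (h01 y).2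
      have h2 : ∫ y in Set.Ioi x, (1 : ℝ) ∂μ ≤ 1 := by
        simp
      simp only [rejectionProb, Set.mem_Icc]
      constructor
      · linarith
      · linarith [hnn x]
    · simp only [rejectionProb]
      have := setIntegral_mono_set (μ := μ) (s := Set.Ioi y) (t := Set.Ioi x)
        hint.integrableOn (Filter.Eventually.of_forall fun z => (h01 z).1)
        (Set.Ioi_subset_Ioi hxy).eventuallyLE
      linarith

theorem measurable_rejectionProb (μ : Measure ℝ) [IsProbabilityMeasure μ] (n d : ℕ) :
    Measurable (rejectionProb μ n d) := (rejectionProb_mem_Icc_and_measurable μ n d).2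

theorem rejectionProb_mem_Icc (μ : Measure ℝ) [IsProbabilityMeasure μ] (n d : ℕ) (x : ℝ) :
    rejectionProb μ n d x ∈ Set.Icc (0 : ℝ) 1 := (rejectionProb_mem_Icc_and_measurable μ n d).1 x

/-- The limit of the rejection probabilities, in terms of the value of the distribution
function. -/
noncomputable def limitRejection (r : ℕ) (t : ℝ) : ℝ :=
  ((r : ℝ) - 1 - ((r : ℝ) - 2) * t) ^ (-(1 / ((r : ℝ) - 2)))

section limitRejection

variable {r : ℕ}

theorem one_le_limitRejection_base (hr : 3 ≤ r) {t : ℝ} (ht : t ≤ 1) :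
    1 ≤ (r : ℝ) - 1 - ((r : ℝ) - 2) * t := by
  have : (3 : ℝ) ≤ r := by exact_mod_cast hr
  nlinarith

theorem limitRejection_pow (hr : 3 ≤ r) {t : ℝ} (ht : t ≤ 1) (n : ℕ) :
    limitRejection r t ^ n = ((r : ℝ) - 1 - ((r : ℝ) - 2) * t) ^ (-((n : ℝ) / ((r : ℝ) - 2))) := by
  have h := one_le_limitRejection_base hr ht
  rw [limitRejection, ← Real.rpow_natCast, ← Real.rpow_mul (by linarith)]
  congr 1
  ring

theorem limitRejection_mem_Icc (hr : 3 ≤ r) {t : ℝ} (ht : t ≤ 1) :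
    limitRejection r t ∈ Set.Icc (0 : ℝ) 1 := by
  have h := one_le_limitRejection_base hr ht
  have h3 : (3 : ℝ) ≤ r := by exact_mod_cast hr
  refine ⟨Real.rpow_nonneg (by linarith) _, Real.rpow_le_one_of_one_le_of_nonpos h ?_⟩
  have : 0 ≤ 1 / ((r : ℝ) - 2) := by apply div_nonneg <;> linarith
  linarith

theorem hasDerivAt_limitRejection (hr : 3 ≤ r) {t : ℝ} (ht : t ≤ 1) :
    HasDerivAt (limitRejection r) (limitRejection r t ^ (r - 1)) t := by
  have h := one_le_limitRejection_base hr ht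
  have h3 : (3 : ℝ) ≤ r := by exact_mod_cast hr
  have hne : (r : ℝ) - 2 ≠ 0 := by linarith
  have h1 : HasDerivAt (fun t : ℝ => (r : ℝ) - 1 - ((r : ℝ) - 2) * t) (-((r : ℝ) - 2)) t := by
    simpa using ((hasDerivAt_id t).const_mul ((r : ℝ) - 2)).const_sub ((r : ℝ) - 1)
  have h2 := h1.rpow_const (p := -(1 / ((r : ℝ) - 2))) (Or.inl (by linarith))
  refine h2.congr_deriv ?_
  rw [limitRejection_pow hr ht, Nat.cast_sub (by omega), Nat.cast_one]
  have e : -(((r : ℝ) - 1) / ((r : ℝ) - 2)) = -(1 / ((r : ℝ) - 2)) - 1 := by field_simp; ring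
  rw [e]
  field_simp

theorem measurable_limitRejection : Measurable (limitRejection r) := by
  unfold limitRejection
  fun_prop

-- The differential equation q' = q^(r-1) with q(1) = 1, integrated from F(x) to 1 and pulled back
-- along F.
open ProbabilityTheory in
theorem limitRejection_cdf_eq (μ : Measure ℝ) [IsProbabilityMeasure μ] [NullSingletonClass μ] (hr : 3 ≤ r)
    (x : ℝ) : limitRejection r (cdf μ x) =
      1 - ∫ y in Set.Ioi x, limitRejection r (cdf μ y) ^ (r - 1) ∂μ := by
  have h01 := cdf_le_one μ x
  have hle : ∀ t ∈ Set.uIcc (cdf μ x) 1, t ≤ 1 := fun t ht => by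
    rw [Set.uIcc_of_le h01] at ht; exact ht.2
  rw [setIntegral_Ioi_comp_cdf μ (h := fun s => limitRejection r s ^ (r - 1))
    (measurable_limitRejection.pow_const _),
    intervalIntegral.integral_eq_sub_of_hasDerivAt
      fun t ht => hasDerivAt_limitRejection hr (hle t ht)]
  · have : limitRejection r 1 = 1 := by
      rw [limitRejection]; ring_nf; simp
    rw [this]; ring
  · refine ContinuousOn.intervalIntegrable fun t ht => ?_
    exact ((hasDerivAt_limitRejection hr (hle t ht)).continuousAt.pow _).continuousWithinAt

end limitRejection

-- The recursion reverses order and starts at 1, above its fixed point. For the error, powers of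
-- numbers in [0, 1] satisfy |a^(r-1) - b^(r-1)| ≤ (r-1)|a - b|, and integrating (1 - F)^(d+1) over
-- (x, ∞) gives (1 - F)^(d+2)/(d+2), whence the factorial.
open ProbabilityTheory in
theorem rejectionProb_sandwich (μ : Measure ℝ) [IsProbabilityMeasure μ] [NullSingletonClass μ] {r : ℕ}
    (hr : 3 ≤ r) (d : ℕ) (x : ℝ) :
    (Even d → limitRejection r (cdf μ x) ≤ rejectionProb μ (r - 1) d x) ∧
    (Odd d → rejectionProb μ (r - 1) d x ≤ limitRejection r (cdf μ x)) ∧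
    |rejectionProb μ (r - 1) d x - limitRejection r (cdf μ x)| ≤
      ((r : ℝ) - 1) ^ d * (1 - cdf μ x) ^ (d + 1) / (d + 1)! := by
  have hq01 : ∀ x, limitRejection r (cdf μ x) ∈ Set.Icc (0 : ℝ) 1 := fun x =>
    limitRejection_mem_Icc hr (cdf_le_one μ x)
  have hqm : Measurable fun x => limitRejection r (cdf μ x) :=
    measurable_limitRejection.comp (continuous_cdf μ).measurable
  have hpow : ∀ {h : ℝ → ℝ}, Measurable h → (∀ x, h x ∈ Set.Icc (0 : ℝ) 1) →
      Integrable (fun y => h y ^ (r - 1)) μ := fun hm h01 =>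
    integrable_of_measurable_of_mem_Icc (hm.pow_const _) fun y =>
      ⟨pow_nonneg (h01 y).1 _, pow_le_one₀ (h01 y).1 (h01 y).2⟩
  have hqi := hpow hqm hq01
  have hr1 : ((r - 1 : ℕ) : ℝ) = (r : ℝ) - 1 := by rw [Nat.cast_sub (by omega), Nat.cast_one]
  have hrpos : (0 : ℝ) ≤ (r : ℝ) - 1 := by rw [← hr1]; positivity
  induction d generalizing x with
  | zero =>
    refine ⟨fun _ => (hq01 x).2, fun h => by simp at h, ?_⟩
    simp only [rejectionProb, pow_zero, zero_add, pow_one, one_mul, Nat.factorial_one, Nat.cast_one,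
      div_one]
    rw [abs_of_nonneg (by linarith [(hq01 x).2]), ← measureReal_Ioi_eq_one_sub_cdf,
      limitRejection_cdf_eq μ hr]
    have : ∫ y in Set.Ioi x, limitRejection r (cdf μ y) ^ (r - 1) ∂μ
        ≤ ∫ y in Set.Ioi x, (1 : ℝ) ∂μ :=
      integral_mono hqi.integrableOn (integrable_const _) fun y =>
        pow_le_one₀ (hq01 y).1 (hq01 y).2
    simp only [integral_const, MeasurableSet.univ, measureReal_restrict_apply, Set.univ_inter,
      smul_eq_mul, mul_one] at this
    linarith
  | succ d ih =>
    have hTi := hpow (measurable_rejectionProb μ (r - 1) d) (rejectionProb_mem_Icc μ (r - 1) d)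
    rw [limitRejection_cdf_eq μ hr, rejectionProb]
    refine ⟨fun he => ?_, fun ho => ?_, ?_⟩
    · have ho : Odd d := by rwa [Nat.even_add_one, Nat.not_even_iff_odd] at he
      have := setIntegral_mono (s := Set.Ioi x) hTi.integrableOn hqi.integrableOn fun y =>
        pow_le_pow_left₀ (rejectionProb_mem_Icc μ (r - 1) d y).1 ((ih y).2.1 ho) (r - 1)
      linarith
    · have he : Even d := by rwa [Nat.odd_add_one, Nat.not_odd_iff_even] at ho
      have := setIntegral_mono (s := Set.Ioi x) hqi.integrableOn hTi.integrableOn fun y =>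
        pow_le_pow_left₀ (hq01 y).1 ((ih y).1 he) (r - 1)
      linarith
    · rw [sub_sub_sub_cancel_left, ← integral_sub hqi.integrableOn hTi.integrableOn]
      have hbound : ∀ y, ‖limitRejection r (cdf μ y) ^ (r - 1) -
          rejectionProb μ (r - 1) d y ^ (r - 1)‖ ≤
          ((r : ℝ) - 1) ^ (d + 1) / (d + 1)! * (1 - cdf μ y) ^ (d + 1) := by
        intro y
        have hT := rejectionProb_mem_Icc μ (r - 1) d y
        rw [Real.norm_eq_abs, abs_sub_comm]
        refine (abs_pow_sub_pow_le _ _ _).trans ?_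
        have h1 : max |rejectionProb μ (r - 1) d y| |limitRejection r (cdf μ y)| ^ (r - 1 - 1)
            ≤ 1 := by
          refine pow_le_one₀ (le_max_of_le_left (abs_nonneg _)) (max_le ?_ ?_)
          · rw [abs_of_nonneg hT.1]; exact hT.2
          · rw [abs_of_nonneg (hq01 y).1]; exact (hq01 y).2
        refine (mul_le_of_le_one_right (by positivity) h1).trans ?_
        rw [hr1]
        refine (mul_le_mul_of_nonneg_right (ih y).2.2 hrpos).trans (le_of_eq ?_)
        ring
      have hbi : Integrable (fun y => ((r : ℝ) - 1) ^ (d + 1) / (d + 1)! *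
          (1 - cdf μ y) ^ (d + 1)) μ := by
        refine Integrable.const_mul (integrable_of_measurable_of_mem_Icc ?_ fun y => ?_) _
        · exact ((continuous_const.sub (continuous_cdf μ)).pow _).measurable
        · have := cdf_nonneg μ y
          have := cdf_le_one μ y
          exact ⟨pow_nonneg (by linarith) _, pow_le_one₀ (by linarith) (by linarith)⟩
      refine (norm_integral_le_of_norm_le hbi.integrableOn
        (Filter.Eventually.of_forall hbound)).trans (le_of_eq ?_)
      rw [integral_const_mul, setIntegral_Ioi_one_sub_cdf_pow, Nat.factorial_succ (d + 1)]
      push_cast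
      field_simp

/-! ### Independence of the node weights -/

instance {V : Type*} [Fintype V] (μ : Measure ℝ) [IsProbabilityMeasure μ] :
    IsProbabilityMeasure (iidWeights V μ) := by
  unfold iidWeights; infer_instance

theorem measurable_extend_zero {V : Type*} [DecidableEq V] (s : Finset V) :
    Measurable fun (z : s → ℝ) (x : V) => if h : x ∈ s then z ⟨x, h⟩ else 0 :=
  measurable_pi_lambda _ fun x => by
    by_cases h : x ∈ s
    · simp only [h, dite_true]; exact measurable_pi_apply _
    · simp only [h, dite_false]; exact measurable_const

theorem measurable_update_zero {V : Type*} [DecidableEq V] (v : V) :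
    Measurable fun w : V → ℝ => Function.update w v 0 :=
  measurable_update'.comp (measurable_id.prodMk measurable_const)

section iid

variable {V : Type*} [Fintype V] (μ : Measure ℝ) [IsProbabilityMeasure μ]

open ProbabilityTheory

theorem iIndepFun_iidWeights : iIndepFun (fun (v : V) (w : V → ℝ) => w v) (iidWeights V μ) :=
  iIndepFun_pi (X := fun _ x => x) fun _ => aemeasurable_id

theorem measurePreserving_eval_iidWeights (v : V) :
    MeasurePreserving (fun w : V → ℝ => w v) (iidWeights V μ) μ :=
  measurePreserving_eval (fun _ => μ) v

/-- Overwriting the coordinate `v` by 0 keeps exactly the information of the other weights, without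
leaving the space `V → ℝ`; this part is independent of `w v`. -/
theorem map_eval_update_iidWeights [DecidableEq V] (v : V) :
    (iidWeights V μ).map (fun w => (w v, Function.update w v 0)) =
      μ.prod ((iidWeights V μ).map fun w => Function.update w v 0) := by
  have h1 := (iIndepFun_iidWeights (V := V) μ).indepFun_finset {v} {v}ᶜ
    disjoint_compl_right fun i => measurable_pi_apply i
  have hev : Measurable fun z : ({v} : Finset V) → ℝ => z ⟨v, by simp⟩ := measurable_pi_apply _
  have hext : Measurable fun (z : ({v}ᶜ : Finset V) → ℝ) (x : V) =>
      if h : x ∈ ({v}ᶜ : Finset V) then z ⟨x, h⟩ else 0 :=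
    measurable_extend_zero _
  have h2 := h1.comp hev hext
  have hu : ((fun (z : ({v}ᶜ : Finset V) → ℝ) (x : V) =>
      if h : x ∈ ({v}ᶜ : Finset V) then z ⟨x, h⟩ else 0) ∘ fun (w : V → ℝ) i => w i) =
      fun w => Function.update w v 0 := by
    ext w x
    by_cases hx : x = v
    · subst hx; simp
    · simp [hx]
  rw [hu] at h2
  have h3 := h2.map_prod_eq_prod_map_map (measurable_pi_apply v).aemeasurable
    (measurable_update_zero v).aemeasurable
  refine h3.trans ?_
  congr 1
  exact (measurePreserving_eval_iidWeights μ v).map_eq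

/-- Integration over the weight of `v` first, for an event given by a relation between that
weight and the other weights. -/
theorem setIntegral_eval_eq_integral (v : V) {A : Set (ℝ × (V → ℝ))} (hA : MeasurableSet A)
    (hdep : ∀ y w w', (∀ x ≠ v, w x = w' x) → ((y, w) ∈ A ↔ (y, w') ∈ A)) {h : ℝ → ℝ}
    (hm : Measurable h) (hint : Integrable h μ) :
    ∫ w in {w | (w v, w) ∈ A}, h (w v) ∂iidWeights V μ =
      ∫ y, h y * (iidWeights V μ).real {w | (y, w) ∈ A} ∂μ := by
  classical
  have hupd : Measurable fun w : V → ℝ => Function.update w v 0 :=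
    measurable_update_zero v
  have hpair : Measurable fun w : V → ℝ => (w v, Function.update w v 0) :=
    (measurable_pi_apply v).prodMk hupd
  have hAu : ∀ y w, (y, Function.update w v 0) ∈ A ↔ (y, w) ∈ A := fun y w =>
    hdep y _ _ fun x hx => Function.update_of_ne hx _ _
  have hdiag : Measurable fun w : V → ℝ => (w v, w) := (measurable_pi_apply v).prodMk measurable_id
  have hPhi : Measurable (A.indicator fun z : ℝ × (V → ℝ) => h z.1) :=
    (hm.comp measurable_fst).indicator hA
  have hcomp : ∀ w : V → ℝ, {w : V → ℝ | (w v, w) ∈ A}.indicator (fun w => h (w v)) w =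
      A.indicator (fun z : ℝ × (V → ℝ) => h z.1) (w v, Function.update w v 0) := by
    intro w
    simp only [Set.indicator_apply, hAu, Set.mem_ofPred_eq]
  have hint2 : Integrable ({w : V → ℝ | (w v, w) ∈ A}.indicator (fun w => h (w v)))
      (iidWeights V μ) :=
    (((measurePreserving_eval_iidWeights μ v).integrable_comp
      hint.aestronglyMeasurable).2 hint).indicator (hdiag hA)
  have hprob : IsProbabilityMeasure ((iidWeights V μ).map fun w => Function.update w v 0) :=
    Measure.isProbabilityMeasure_map hupd.aemeasurable
  have hB : MeasurableSet {w : V → ℝ | (w v, w) ∈ A} := hdiag hA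
  rw [← integral_indicator hB]
  simp_rw [hcomp]
  rw [← integral_map hpair.aemeasurable hPhi.aestronglyMeasurable, map_eval_update_iidWeights,
    integral_prod]
  · refine integral_congr_ae (Filter.Eventually.of_forall fun y => ?_)
    have hm1 : Measurable fun z : V → ℝ =>
        A.indicator (fun z : ℝ × (V → ℝ) => h z.1) (y, z) :=
      hPhi.comp measurable_prodMk_left
    simp only
    rw [integral_map hupd.aemeasurable hm1.aestronglyMeasurable]
    have : (fun w : V → ℝ => A.indicator (fun z : ℝ × (V → ℝ) => h z.1)
        (y, Function.update w v 0)) = {w | (y, w) ∈ A}.indicator fun _ => h y := by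
      ext w
      simp only [Set.indicator_apply, hAu, Set.mem_ofPred_eq]
    have hAy : MeasurableSet {w : V → ℝ | (y, w) ∈ A} := measurable_prodMk_left hA
    rw [this, integral_indicator_const _ hAy, smul_eq_mul, mul_comm]
  · rw [← map_eval_update_iidWeights,
      integrable_map_measure hPhi.aestronglyMeasurable hpair.aemeasurable]
    exact hint2.congr (Filter.Eventually.of_forall hcomp)

/-- Extension by zero turns each event into one about the coordinates in `S` or `T` alone, and these
two families are independent. -/
theorem measureReal_inter_eq_mul {S T : Set V} (hST : Disjoint S T) {A B : Set (V → ℝ)}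
    (hA : MeasurableSet A) (hB : MeasurableSet B)
    (hAS : ∀ w w', (∀ x ∈ S, w x = w' x) → (w ∈ A ↔ w' ∈ A))
    (hBT : ∀ w w', (∀ x ∈ T, w x = w' x) → (w ∈ B ↔ w' ∈ B)) :
    (iidWeights V μ).real (A ∩ B) = (iidWeights V μ).real A * (iidWeights V μ).real B := by
  classical
  have hd : Disjoint S.toFinset T.toFinset := Set.disjoint_toFinset.2 hST
  have hind := (iIndepFun_iidWeights (V := V) μ).indepFun_finset _ _ hd
    fun i => measurable_pi_apply i
  have hmul := hind.measure_inter_preimage_eq_mul _ _ (measurable_extend_zero S.toFinset hA)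
    (measurable_extend_zero T.toFinset hB)
  have hpre : ∀ {U : Set V} {C : Set (V → ℝ)},
      (∀ w w', (∀ x ∈ U, w x = w' x) → (w ∈ C ↔ w' ∈ C)) →
      (fun (w : V → ℝ) (i : U.toFinset) => w i) ⁻¹' ((fun (z : U.toFinset → ℝ) (x : V) =>
        if h : x ∈ U.toFinset then z ⟨x, h⟩ else 0) ⁻¹' C) = C := by
    intro U C hUC
    ext w
    refine hUC _ _ fun x hx => ?_
    simp [hx]
  rw [hpre hAS, hpre hBT] at hmul
  simp only [measureReal_def, hmul, ENNReal.toReal_mul]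

theorem measureReal_biInter_eq_prod (s : Finset V) (S : V → Set V) (A : V → Set (V → ℝ))
    (hA : ∀ u, MeasurableSet (A u))
    (hdep : ∀ u ∈ s, ∀ w w', (∀ x ∈ S u, w x = w' x) → (w ∈ A u ↔ w' ∈ A u))
    (hdisj : (s : Set V).PairwiseDisjoint S) :
    (iidWeights V μ).real (⋂ u ∈ s, A u) = ∏ u ∈ s, (iidWeights V μ).real (A u) := by
  classical
  induction s using Finset.induction_on with
  | empty => simp
  | insert a s ha ih =>
    rw [Finset.set_biInter_insert, Finset.prod_insert ha,
      ← ih (fun u hu => hdep u (Finset.mem_insert_of_mem hu))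
        (hdisj.subset (by simp))]
    refine measureReal_inter_eq_mul μ (S := S a) (T := ⋃ u ∈ s, S u) ?_ (hA a)
      (Finset.measurableSet_biInter s fun u _ => hA u) (hdep a (Finset.mem_insert_self a s)) ?_
    · rw [Set.disjoint_iUnion₂_right]
      exact fun u hu => hdisj (by simp) (by simp [hu]) fun h => ha (h ▸ hu)
    · intro w w' hw
      simp only [Set.mem_iInter]
      exact forall_congr' fun u => forall_congr' fun hu =>
        hdep u (Finset.mem_insert_of_mem hu) w w' fun x hx => hw x (Set.mem_iUnion₂.2 ⟨u, hu, hx⟩)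

end iid

/-! ### Truncated decisions and increasing paths under random weights -/

section events

variable {V : Type*} [Fintype V] (G : SimpleGraph V)

theorem measurable_localDecision (d : ℕ) (p v : V) :
    Measurable fun w : V → ℝ => localDecision G w d p v := by
  induction d generalizing p v with
  | zero => exact measurable_const
  | succ d ih =>
    refine Measurable.forall fun u => Measurable.imp measurable_const <|
      Measurable.imp measurable_const <| Measurable.imp ?_ (ih v u).not
    exact measurableSet_setOfPred.1
      (measurableSet_lt (measurable_pi_apply v) (measurable_pi_apply u))

theorem measurable_hasIncreasingPath (d : ℕ) (p v : V) :
    Measurable fun w : V → ℝ => HasIncreasingPath G w d p v := by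
  induction d generalizing p v with
  | zero => exact measurable_const
  | succ d ih =>
    refine Measurable.exists fun u => Measurable.and measurable_const <|
      Measurable.and measurable_const <| Measurable.and ?_ (ih v u)
    exact measurableSet_setOfPred.1
      (measurableSet_lt (measurable_pi_apply v) (measurable_pi_apply u))

end events

/-- Makes a probability a case of the weighted integrals below, so that one recursion serves inner
nodes (`h` an indicator) and the root (`h` the identity). -/
theorem setIntegral_one_eq_measureReal_lt_and {V : Type*} [Fintype V] (μ : Measure ℝ)
    (D : (V → ℝ) → Prop) (v : V)
    (x : ℝ) : ∫ w in {w | D w}, (Set.Ioi x).indicator (fun _ => (1 : ℝ)) (w v) ∂iidWeights V μ =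
      (iidWeights V μ).real {w | x < w v ∧ D w} := by
  have h1 : MeasurableSet {w : V → ℝ | x < w v} :=
    measurableSet_lt measurable_const (measurable_pi_apply v)
  have h2 : (fun w : V → ℝ => (Set.Ioi x).indicator (fun _ => (1 : ℝ)) (w v)) =
      {w : V → ℝ | x < w v}.indicator fun _ => (1 : ℝ) := by
    ext w; simp [Set.indicator_apply]
  rw [h2, integral_indicator_const _ h1, smul_eq_mul, mul_one, measureReal_restrict_apply h1]
  rfl

section recursion

variable {V : Type*} [Fintype V] {G : SimpleGraph V} (μ : Measure ℝ) [IsProbabilityMeasure μ]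
  {g : ℕ}

/-- Given w v = y, the node is kept iff no `u ∈ s` both exceeds y and is kept in its own branch. The
branches are disjoint and avoid `v`, so the probabilities multiply. The exponent `s.card` is r - 1
at inner nodes and r at the root. -/
theorem setIntegral_localDecision_succ (hg : (g : ℕ∞) ≤ G.egirth) (n d : ℕ)
    (hd : 2 * (d + 1) < g) (p v : V) (s : Finset V) (hs : ∀ u, u ∈ s ↔ G.Adj v u ∧ u ≠ p)
    (hprob : ∀ u ∈ s, ∀ y, (iidWeights V μ).real {w | y < w u ∧ localDecision G w d v u} =
      1 - rejectionProb μ n (d + 1) y)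
    {h : ℝ → ℝ} (hm : Measurable h) (hint : Integrable h μ) :
    ∫ w in {w | localDecision G w (d + 1) p v}, h (w v) ∂iidWeights V μ =
      ∫ y, h y * rejectionProb μ n (d + 1) y ^ s.card ∂μ := by
  have hE : ∀ u y, MeasurableSet {w : V → ℝ | y < w u ∧ localDecision G w d v u} := fun u y =>
    (measurableSet_lt measurable_const (measurable_pi_apply u)).inter
      (measurableSet_setOfPred.2 (measurable_localDecision G d v u))
  have hdepE : ∀ u ∈ s, ∀ (y : ℝ) (w w' : V → ℝ), (∀ x ∈ branch G d v u, w x = w' x) →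
      ((y < w u ∧ localDecision G w d v u) ↔ (y < w' u ∧ localDecision G w' d v u)) := by
    intro u hu y w w' hw
    have hvu := ((hs u).1 hu).1
    rw [hw u (mem_branch_self d hvu), localDecision_congr hg d (by omega) hvu hw]
  let A : Set (ℝ × (V → ℝ)) :=
    {z | ∀ u, u ∈ s → ¬ (z.1 < z.2 u ∧ localDecision G z.2 d v u)}
  have hA : MeasurableSet A := by
    refine measurableSet_setOfPred.2 (Measurable.forall fun u => Measurable.imp measurable_const
      (Measurable.not (Measurable.and ?_ ?_)))
    · exact measurableSet_setOfPred.1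
        (measurableSet_lt measurable_fst ((measurable_pi_apply u).comp measurable_snd))
    · exact (measurable_localDecision G d v u).comp measurable_snd
  have hset : {w | localDecision G w (d + 1) p v} = {w | (w v, w) ∈ A} := by
    ext w
    refine forall_congr' fun u => ?_
    rw [hs u]
    tauto
  rw [hset, setIntegral_eval_eq_integral μ v hA _ hm hint]
  · refine integral_congr_ae (Filter.Eventually.of_forall fun y => ?_)
    have hint : {w | (y, w) ∈ A} =
        ⋂ u ∈ s, {w : V → ℝ | y < w u ∧ localDecision G w d v u}ᶜ := by
      ext w; simp [A]
    simp only
    rw [hint, measureReal_biInter_eq_prod μ s (branch G d v) _ fun u => (hE u y).compl]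
    · rw [Finset.prod_congr rfl fun u hu => by
        rw [probReal_compl_eq_one_sub (hE u y), hprob u hu y, sub_sub_cancel]]
      rw [Finset.prod_const]
    · intro u hu w w' hw
      exact not_congr (hdepE u hu y w w' hw)
    · intro a ha b hb hab
      exact disjoint_branch hg hd hab
  · intro y w w' hw
    refine forall_congr' fun u => imp_congr_right fun hu => not_congr (hdepE u hu y w w' ?_)
    intro x hx
    exact hw x fun hxv => notMem_branch d v u (hxv ▸ hx)

/-- A union bound over the next node. Branches need not be disjoint, only independent of the weight
of `v`, so the girth condition is weaker than for decisions. -/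
theorem setIntegral_hasIncreasingPath_succ_le (hg : (g : ℕ∞) ≤ G.egirth) (d : ℕ)
    (hd : d + 1 < g) (p v : V) (s : Finset V) (hs : ∀ u, u ∈ s ↔ G.Adj v u ∧ u ≠ p)
    {R : ℝ → ℝ}
    (hprob : ∀ u ∈ s, ∀ y, (iidWeights V μ).real {w | y < w u ∧ HasIncreasingPath G w d v u} ≤ R y)
    {h : ℝ → ℝ} (hm : Measurable h) (hint : Integrable h μ) (hnn : 0 ≤ᵐ[μ] h)
    (hRint : Integrable (fun y => h y * (s.card * R y)) μ) :
    ∫ w in {w | HasIncreasingPath G w (d + 1) p v}, h (w v) ∂iidWeights V μ ≤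
      ∫ y, h y * (s.card * R y) ∂μ := by
  let A : Set (ℝ × (V → ℝ)) :=
    {z | ∃ u, u ∈ s ∧ (z.1 < z.2 u ∧ HasIncreasingPath G z.2 d v u)}
  have hA : MeasurableSet A := by
    refine measurableSet_setOfPred.2 (Measurable.exists fun u => Measurable.and measurable_const
      (Measurable.and ?_ ?_))
    · exact measurableSet_setOfPred.1
        (measurableSet_lt measurable_fst ((measurable_pi_apply u).comp measurable_snd))
    · exact (measurable_hasIncreasingPath G d v u).comp measurable_snd
  have hset : {w | HasIncreasingPath G w (d + 1) p v} = {w | (w v, w) ∈ A} := by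
    ext w
    refine exists_congr fun u => ?_
    rw [hs u]
    tauto
  rw [hset, setIntegral_eval_eq_integral μ v hA _ hm hint]
  · refine integral_mono_of_nonneg ?_ hRint ?_
    · filter_upwards [hnn] with y hy
      exact mul_nonneg hy measureReal_nonneg
    · filter_upwards [hnn] with y hy
      refine mul_le_mul_of_nonneg_left ?_ hy
      have hun : {w | (y, w) ∈ A} =
          ⋃ u ∈ s, {w : V → ℝ | y < w u ∧ HasIncreasingPath G w d v u} := by
        ext w
        simp only [A, Set.mem_ofPred_eq, Set.mem_iUnion, exists_prop]
      rw [hun]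
      refine (measureReal_biUnion_finset_le _ _).trans ?_
      refine (Finset.sum_le_sum fun u hu => hprob u hu y).trans ?_
      simp
  · intro y w w' hw
    refine exists_congr fun u => and_congr_right fun hu => ?_
    have hvu := ((hs u).1 hu).1
    have hw2 : ∀ x ∈ branch G d v u, w x = w' x := fun x hx =>
      hw x fun hxv => notMem_branch d v u (hxv ▸ hx)
    change (y < w u ∧ HasIncreasingPath G w d v u) ↔ (y < w' u ∧ HasIncreasingPath G w' d v u)
    rw [hw2 u (mem_branch_self d hvu), hasIncreasingPath_congr hg d hd hvu hw2]

variable [DecidableRel G.Adj] {r : ℕ}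

theorem card_neighborFinset_erase [DecidableEq V] (hr : G.IsRegularOfDegree r) {p v : V}
    (h : G.Adj p v) : ((G.neighborFinset v).erase p).card = r - 1 := by
  rw [Finset.card_erase_of_mem (by simpa using h.symm), SimpleGraph.card_neighborFinset_eq_degree,
    hr v]

/-- The index shifts by one because `rejectionProb` also integrates over the weight of the node
itself. -/
theorem measureReal_lt_and_localDecision (hg : (g : ℕ∞) ≤ G.egirth)
    (hr : G.IsRegularOfDegree r) (d : ℕ) (hd : 2 * d < g) {p v : V} (hpv : G.Adj p v) (x : ℝ) :
    (iidWeights V μ).real {w | x < w v ∧ localDecision G w d p v} =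
      1 - rejectionProb μ (r - 1) (d + 1) x := by
  classical
  induction d generalizing p v x with
  | zero =>
    have h1 := (measurePreserving_eval_iidWeights μ v).measureReal_preimage
      (measurableSet_Ioi (a := x)).nullMeasurableSet
    simp only [localDecision, and_true, rejectionProb, one_pow, sub_sub_cancel, integral_const,
      MeasurableSet.univ, measureReal_restrict_apply, Set.univ_inter, smul_eq_mul, mul_one]
    exact h1
  | succ d ih =>
    rw [← setIntegral_one_eq_measureReal_lt_and μ,
      setIntegral_localDecision_succ μ hg (r - 1) d hd p v ((G.neighborFinset v).erase p)
        (fun u => by simp [and_comm])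
        (fun u hu y => ih (by omega) (by simp at hu; exact hu.2) y)
        (measurable_const.indicator measurableSet_Ioi)
        ((integrable_const _).indicator measurableSet_Ioi),
      card_neighborFinset_erase hr hpv, rejectionProb, sub_sub_cancel,
      ← integral_indicator measurableSet_Ioi]
    congr 1
    ext y
    by_cases hy : x < y <;> simp [hy]

open ProbabilityTheory in
theorem measureReal_lt_and_hasIncreasingPath_le [NullSingletonClass μ]
    (hg : (g : ℕ∞) ≤ G.egirth) (hr : G.IsRegularOfDegree r) (hr1 : 1 ≤ r) (d : ℕ) (hd : d < g)
    {p v : V} (hpv : G.Adj p v) (x : ℝ) :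
    (iidWeights V μ).real {w | x < w v ∧ HasIncreasingPath G w d p v} ≤
      ((r : ℝ) - 1) ^ d * (1 - cdf μ x) ^ (d + 1) / (d + 1)! := by
  classical
  induction d generalizing p v x with
  | zero =>
    have h1 := (measurePreserving_eval_iidWeights μ v).measureReal_preimage
      (measurableSet_Ioi (a := x)).nullMeasurableSet
    rw [measureReal_Ioi_eq_one_sub_cdf] at h1
    simp only [HasIncreasingPath, and_true, pow_zero, zero_add, pow_one, one_mul,
      Nat.factorial_one, Nat.cast_one, div_one]
    exact h1.le
  | succ d ih =>
    have hcast : ((r - 1 : ℕ) : ℝ) = (r : ℝ) - 1 := by rw [Nat.cast_sub hr1, Nat.cast_one]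
    have heq : (fun y => (Set.Ioi x).indicator (fun _ => (1 : ℝ)) y * (((r - 1 : ℕ) : ℝ) *
        (((r : ℝ) - 1) ^ d * (1 - cdf μ y) ^ (d + 1) / (d + 1)!))) =
        (Set.Ioi x).indicator fun y =>
          ((r : ℝ) - 1) ^ (d + 1) / (d + 1)! * (1 - cdf μ y) ^ (d + 1) := by
      ext y
      rw [hcast]
      by_cases hy : x < y
      · simp [hy]; ring
      · simp [hy]
    have hbi : Integrable (fun y => ((r : ℝ) - 1) ^ (d + 1) / (d + 1)! *
        (1 - cdf μ y) ^ (d + 1)) μ := by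
      refine Integrable.const_mul (integrable_of_measurable_of_mem_Icc ?_ fun y => ?_) _
      · exact ((continuous_const.sub (continuous_cdf μ)).pow _).measurable
      · have := cdf_nonneg μ y
        have := cdf_le_one μ y
        exact ⟨pow_nonneg (by linarith) _, pow_le_one₀ (by linarith) (by linarith)⟩
    have hcard := card_neighborFinset_erase hr hpv
    rw [← setIntegral_one_eq_measureReal_lt_and μ]
    refine (setIntegral_hasIncreasingPath_succ_le μ hg d hd p v ((G.neighborFinset v).erase p)
        (fun u => by simp [and_comm])
        (fun u hu y => ih (by omega) (by simp at hu; exact hu.2) y)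
        (measurable_const.indicator measurableSet_Ioi)
        ((integrable_const _).indicator measurableSet_Ioi)
        (Filter.Eventually.of_forall fun y => Set.indicator_nonneg (fun _ _ => zero_le_one) y)
        ?_).trans (le_of_eq ?_)
    · rw [hcard, heq]
      exact hbi.indicator measurableSet_Ioi
    · rw [hcard, heq, integral_indicator measurableSet_Ioi, integral_const_mul,
        setIntegral_Ioi_one_sub_cdf_pow, Nat.factorial_succ (d + 1)]
      push_cast
      field_simp

theorem setIntegral_localDecision_eq (hg : (g : ℕ∞) ≤ G.egirth) (hr : G.IsRegularOfDegree r)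
    (hμ : Integrable id μ) (d : ℕ) (hd : 2 * (d + 1) < g) (v : V) :
    ∫ w in {w | localDecision G w (d + 1) v v}, w v ∂iidWeights V μ =
      ∫ y, y * rejectionProb μ (r - 1) (d + 1) y ^ r ∂μ := by
  have := setIntegral_localDecision_succ μ hg (r - 1) d hd v v (G.neighborFinset v)
    (fun u => by simpa using fun h : G.Adj v u => h.ne') (fun u hu y =>
      measureReal_lt_and_localDecision μ hg hr d (by omega) (by simpa using hu) y)
    measurable_id hμ
  rwa [SimpleGraph.card_neighborFinset_eq_degree, hr v] at this

open ProbabilityTheory in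
theorem setIntegral_hasIncreasingPath_le [NullSingletonClass μ] (hg : (g : ℕ∞) ≤ G.egirth)
    (hr : G.IsRegularOfDegree r) (hr1 : 1 ≤ r) (hμ : Integrable id μ) (hnn : 0 ≤ᵐ[μ] id) (d : ℕ)
    (hd : d + 1 < g) (v : V) :
    ∫ w in {w | HasIncreasingPath G w (d + 1) v v}, w v ∂iidWeights V μ ≤
      (∫ y, y ∂μ) * (r * ((r : ℝ) - 1) ^ d / (d + 1)!) := by
  have hcast : (0 : ℝ) ≤ (r : ℝ) - 1 := by
    have : (1 : ℝ) ≤ r := by exact_mod_cast hr1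
    linarith
  -- At the root the factor (1 - F(y))^(d+1) is bounded by 1; the bound `R` is then constant and the
  -- mean factors out.
  refine (setIntegral_hasIncreasingPath_succ_le μ hg d hd v v (G.neighborFinset v)
    (R := fun _ => ((r : ℝ) - 1) ^ d / (d + 1)!)
    (fun u => by simpa using fun h : G.Adj v u => h.ne') (fun u hu y => ?_)
    measurable_id hμ hnn (hμ.mul_const _)).trans (le_of_eq ?_)
  · refine (measureReal_lt_and_hasIncreasingPath_le μ hg hr hr1 d (by omega)
      (by simpa using hu) y).trans ?_
    have h0 := cdf_nonneg μ y
    have h1 := cdf_le_one μ y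
    gcongr
    exact mul_le_of_le_one_right (by positivity) (pow_le_one₀ (by linarith) (by linarith))
  · rw [SimpleGraph.card_neighborFinset_eq_degree, hr v, integral_mul_const]
    simp only [id]
    ring

end recursion

/-! ### The contribution of a node to the greedy weight -/

theorem setIntegral_le_and_le_add {α : Type*} [MeasurableSpace α] {ν : Measure α} {B C D : Set α}
    (hB : MeasurableSet B) (hC : MeasurableSet C) (hD : MeasurableSet D) {h : α → ℝ}
    (hint : Integrable h ν) (hnn : ∀ᵐ x ∂ν, 0 ≤ h x) (hBC : ∀ᵐ x ∂ν, x ∈ B → x ∈ C)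
    (hCBD : ∀ᵐ x ∂ν, x ∈ C → x ∈ B ∨ x ∈ D) :
    ∫ x in B, h x ∂ν ≤ ∫ x in C, h x ∂ν ∧
      ∫ x in C, h x ∂ν ≤ ∫ x in B, h x ∂ν + ∫ x in D, h x ∂ν := by
  have hiB := hint.indicator hB
  have hiC := hint.indicator hC
  have hiD := hint.indicator hD
  rw [← integral_indicator hB, ← integral_indicator hC, ← integral_indicator hD,
    ← integral_add hiB hiD]
  refine ⟨integral_mono_ae hiB hiC ?_, integral_mono_ae hiC (hiB.add hiD) ?_⟩
  · filter_upwards [hnn, hBC] with x h0 h1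
    by_cases hxB : x ∈ B
    · rw [Set.indicator_of_mem hxB, Set.indicator_of_mem (h1 hxB)]
    · rw [Set.indicator_of_notMem hxB]
      exact Set.indicator_apply_nonneg fun _ => h0
  · filter_upwards [hnn, hCBD] with x h0 h1
    have hBn : 0 ≤ B.indicator h x := Set.indicator_apply_nonneg fun _ => h0
    have hDn : 0 ≤ D.indicator h x := Set.indicator_apply_nonneg fun _ => h0
    by_cases hxC : x ∈ C
    · rw [Set.indicator_of_mem hxC]
      rcases h1 hxC with hx | hx
      · rw [Set.indicator_of_mem (s := B) hx]; linarith
      · rw [Set.indicator_of_mem (s := D) hx]; linarith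
    · rw [Set.indicator_of_notMem hxC]; linarith

section greedy

variable {V : Type*} [Fintype V] (G : SimpleGraph V) (μ : Measure ℝ) [IsProbabilityMeasure μ]

theorem ae_iidWeights_injective [NullSingletonClass μ] :
    ∀ᵐ w ∂iidWeights V μ, Function.Injective w := by
  have hne : ∀ i j : V, i ≠ j → ∀ᵐ w ∂iidWeights V μ, w i ≠ w j := by
    intro i j hij
    -- Integrating over w i first leaves, for each value y, the event w j = y, which is null.
    have h1 := setIntegral_eval_eq_integral μ i (A := {z | z.1 = z.2 j})
      (measurableSet_eq_fun measurable_fst ((measurable_pi_apply j).comp measurable_snd))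
      (fun y w w' hw => by simp [hw j hij.symm]) (h := fun _ => (1 : ℝ)) measurable_const
      (integrable_const _)
    have h2 : ∀ y, (iidWeights V μ).real {w | y = w j} = 0 := fun y => by
      have h3 := (measurePreserving_eval_iidWeights μ j).measureReal_preimage
        (measurableSet_singleton y).nullMeasurableSet
      have h4 : {w : V → ℝ | y = w j} = (fun w => w j) ⁻¹' {y} := by
        ext w; simp [eq_comm]
      rw [h4, h3, measureReal_def, measure_singleton, ENNReal.toReal_zero]
    have h5 : (iidWeights V μ).real {w | w i = w j} = 0 := by
      simpa [h2] using h1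
    rw [measureReal_eq_zero_iff] at h5
    exact measure_eq_zero_iff_ae_notMem.1 h5
  have hall : ∀ᵐ w ∂iidWeights V μ, ∀ i j : V, i ≠ j → w i ≠ w j := by
    simp only [ae_all_iff]
    exact hne
  filter_upwards [hall] with w hw i j hij
  by_contra h
  exact hw i j h hij

/-- The expected contribution of the node `v` to the weight of the greedy independent set. -/
noncomputable def greedyContribution (v : V) : ℝ :=
  ∫ w in {w | localDecision G w (Fintype.card V) v v}, w v ∂iidWeights V μ

theorem mem_greedySet_iff_localDecision {w : V → ℝ} (hw : Function.Injective w) (v : V) :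
    v ∈ greedySet G w ↔ localDecision G w (Fintype.card V) v v :=
  (localDecision_sandwich G w _ (mem_greedySet_iff G hw) (Fintype.card V) v v le_rfl).2.2.resolve_right
    fun h => by have := h.lt_card; omega

theorem integrable_eval_iidWeights (hμ : Integrable id μ) (v : V) :
    Integrable (fun w : V → ℝ => w v) (iidWeights V μ) :=
  ((measurePreserving_eval_iidWeights μ v).integrable_comp hμ.aestronglyMeasurable).2 hμ

theorem greedyWeightPerNode_ae_eq [NullSingletonClass μ] :
    greedyWeightPerNode G =ᵐ[iidWeights V μ] fun w =>
      (∑ v, {w | localDecision G w (Fintype.card V) v v}.indicator (fun w => w v) w) /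
        (Fintype.card V : ℝ) := by
  classical
  filter_upwards [ae_iidWeights_injective μ] with w hw
  rw [greedyWeightPerNode]
  congr 1
  rw [← Finset.univ_inter (greedySet G w), ← Finset.sum_ite_mem]
  refine Finset.sum_congr rfl fun v _ => ?_
  rw [Set.indicator_apply]
  exact if_congr (mem_greedySet_iff_localDecision G hw v) rfl rfl

theorem integrable_greedyWeightPerNode [NullSingletonClass μ] (hμ : Integrable id μ) :
    Integrable (greedyWeightPerNode G) (iidWeights V μ) := by
  refine Integrable.congr ?_ (greedyWeightPerNode_ae_eq G μ).symm
  refine Integrable.div_const (integrable_finsetSum _ fun v _ => ?_) _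
  exact (integrable_eval_iidWeights μ hμ v).indicator
    (measurableSet_setOfPred.2 (measurable_localDecision G _ v v))

theorem expectedGreedyWeightPerNode_eq [NullSingletonClass μ] (hμ : Integrable id μ) :
    expectedGreedyWeightPerNode G μ =
      (∑ v, greedyContribution G μ v) / (Fintype.card V : ℝ) := by
  have hm : ∀ v, MeasurableSet {w : V → ℝ | localDecision G w (Fintype.card V) v v} := fun v =>
    measurableSet_setOfPred.2 (measurable_localDecision G _ v v)
  rw [expectedGreedyWeightPerNode, integral_congr_ae (greedyWeightPerNode_ae_eq G μ),
    integral_div, integral_finsetSum _ fun v _ => (integrable_eval_iidWeights μ hμ v).indicator (hm v)]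
  congr 1
  exact Finset.sum_congr rfl fun v _ => integral_indicator (hm v)

variable {G} [DecidableRel G.Adj] {g r : ℕ}

/-- The greedy event and the truncated event are nested according to the parity of `d`, and their
difference lies in the event of an increasing path with `d + 1` edges. -/
theorem greedyContribution_sandwich [NullSingletonClass μ] (hg : (g : ℕ∞) ≤ G.egirth)
    (hr : G.IsRegularOfDegree r) (hr1 : 1 ≤ r) (hμ : Integrable id μ) (hnn : 0 ≤ᵐ[μ] id) (d : ℕ)
    (hd0 : 1 ≤ d) (hd : 2 * d < g) (v : V) :
    (Even d → greedyContribution G μ v ≤ ∫ y, y * rejectionProb μ (r - 1) d y ^ r ∂μ ∧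
      ∫ y, y * rejectionProb μ (r - 1) d y ^ r ∂μ ≤ greedyContribution G μ v +
        (∫ y, y ∂μ) * (r * ((r : ℝ) - 1) ^ d / (d + 1)!)) ∧
    (Odd d → ∫ y, y * rejectionProb μ (r - 1) d y ^ r ∂μ ≤ greedyContribution G μ v ∧
      greedyContribution G μ v ≤ ∫ y, y * rejectionProb μ (r - 1) d y ^ r ∂μ +
        (∫ y, y ∂μ) * (r * ((r : ℝ) - 1) ^ d / (d + 1)!)) := by
  have hloc : ∫ w in {w | localDecision G w d v v}, w v ∂iidWeights V μ =
      ∫ y, y * rejectionProb μ (r - 1) d y ^ r ∂μ := by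
    obtain ⟨e, rfl⟩ := Nat.exists_eq_add_of_le' hd0
    exact setIntegral_localDecision_eq μ hg hr hμ e hd v
  have hpath := setIntegral_hasIncreasingPath_le μ hg hr hr1 hμ hnn d (by omega) v
  rw [← hloc, greedyContribution]
  have hm : ∀ n, MeasurableSet {w : V → ℝ | localDecision G w n v v} := fun n =>
    measurableSet_setOfPred.2 (measurable_localDecision G n v v)
  have hmp : MeasurableSet {w : V → ℝ | HasIncreasingPath G w (d + 1) v v} :=
    measurableSet_setOfPred.2 (measurable_hasIncreasingPath G _ v v)
  have hint := integrable_eval_iidWeights μ hμ v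
  have hnn' : ∀ᵐ w ∂iidWeights V μ, 0 ≤ w v :=
    (measurePreserving_eval_iidWeights μ v).quasiMeasurePreserving.ae hnn
  have hinj := ae_iidWeights_injective (V := V) μ
  refine ⟨fun he => ?_, fun ho => ?_⟩
  · have := setIntegral_le_and_le_add (hm (Fintype.card V)) (hm d) hmp hint hnn'
      (by
        filter_upwards [hinj] with w hw hB
        exact (localDecision_sandwich G w _ (mem_greedySet_iff G hw) d v v le_rfl).1 he
          ((mem_greedySet_iff_localDecision G hw v).2 hB))
      (by
        filter_upwards [hinj] with w hw hC
        rcases (localDecision_sandwich G w _ (mem_greedySet_iff G hw) d v v le_rfl).2.2 with h | h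
        · exact Or.inl ((mem_greedySet_iff_localDecision G hw v).1 (h.2 hC))
        · exact Or.inr h)
    exact ⟨this.1, by linarith [this.2]⟩
  · have := setIntegral_le_and_le_add (hm d) (hm (Fintype.card V)) hmp hint hnn'
      (by
        filter_upwards [hinj] with w hw hB
        exact (mem_greedySet_iff_localDecision G hw v).1
          ((localDecision_sandwich G w _ (mem_greedySet_iff G hw) d v v le_rfl).2.1 ho hB))
      (by
        filter_upwards [hinj] with w hw hC
        rcases (localDecision_sandwich G w _ (mem_greedySet_iff G hw) d v v le_rfl).2.2 with h | h
        · exact Or.inl (h.1 ((mem_greedySet_iff_localDecision G hw v).2 hC))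
        · exact Or.inr h)
    exact ⟨this.1, by linarith [this.2]⟩

end greedy

/-! ### Comparison with the limiting integral -/

section limit

open ProbabilityTheory

theorem integrable_mul_pow_of_mem_Icc {μ : Measure ℝ} (hμ : Integrable id μ) {h : ℝ → ℝ} (hm : Measurable h)
    (h01 : ∀ x, h x ∈ Set.Icc (0 : ℝ) 1) (n : ℕ) : Integrable (fun y => y * h y ^ n) μ := by
  refine hμ.mul_bdd (c := 1) (hm.pow_const n).aestronglyMeasurable
    (Filter.Eventually.of_forall fun y => ?_)
  rw [Real.norm_eq_abs, abs_of_nonneg (pow_nonneg (h01 y).1 _)]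
  exact pow_le_one₀ (h01 y).1 (h01 y).2

theorem limitRejection_cdf_mem_Icc (μ : Measure ℝ) {r : ℕ} (hr : 3 ≤ r) (x : ℝ) :
    limitRejection r (cdf μ x) ∈ Set.Icc (0 : ℝ) 1 :=
  limitRejection_mem_Icc hr (cdf_le_one μ x)

theorem measurable_limitRejection_cdf (μ : Measure ℝ) {r : ℕ} : Measurable fun x => limitRejection r (cdf μ x) :=
  measurable_limitRejection.comp (monotone_cdf μ).measurable

variable (μ : Measure ℝ) [IsProbabilityMeasure μ] {r : ℕ}

theorem integral_rejectionProb_sandwich [NullSingletonClass μ] (hr : 3 ≤ r)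
    (hμ : Integrable id μ) (hnn : 0 ≤ᵐ[μ] id) (d : ℕ) :
    (Even d → ∫ y, y * limitRejection r (cdf μ y) ^ r ∂μ ≤
        ∫ y, y * rejectionProb μ (r - 1) d y ^ r ∂μ) ∧
    (Odd d → ∫ y, y * rejectionProb μ (r - 1) d y ^ r ∂μ ≤
        ∫ y, y * limitRejection r (cdf μ y) ^ r ∂μ) ∧
    |∫ y, y * rejectionProb μ (r - 1) d y ^ r ∂μ - ∫ y, y * limitRejection r (cdf μ y) ^ r ∂μ| ≤
      (∫ y, y ∂μ) * (r * ((r : ℝ) - 1) ^ d / (d + 1)!) := by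
  have hq01 := limitRejection_cdf_mem_Icc μ hr
  have hT01 := rejectionProb_mem_Icc μ (r - 1) d
  have hqi := integrable_mul_pow_of_mem_Icc hμ (measurable_limitRejection_cdf μ) hq01 r
  have hTi := integrable_mul_pow_of_mem_Icc hμ (measurable_rejectionProb μ (r - 1) d) hT01 r
  have hr0 : (0 : ℝ) ≤ (r : ℝ) - 1 := by
    have : (3 : ℝ) ≤ r := by exact_mod_cast hr
    linarith
  refine ⟨fun he => integral_mono_ae hqi hTi ?_, fun ho => integral_mono_ae hTi hqi ?_, ?_⟩
  · filter_upwards [hnn] with y hy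
    exact mul_le_mul_of_nonneg_left
      (pow_le_pow_left₀ (hq01 y).1 ((rejectionProb_sandwich μ hr d y).1 he) r) hy
  · filter_upwards [hnn] with y hy
    exact mul_le_mul_of_nonneg_left
      (pow_le_pow_left₀ (hT01 y).1 ((rejectionProb_sandwich μ hr d y).2.1 ho) r) hy
  · rw [← integral_sub hTi hqi, ← integral_mul_const]
    rw [← Real.norm_eq_abs]
    refine norm_integral_le_of_norm_le (hμ.mul_const _) ?_
    filter_upwards [hnn] with y hy
    have hy : 0 ≤ y := hy
    rw [← mul_sub, norm_mul, Real.norm_of_nonneg hy, Real.norm_eq_abs]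
    refine mul_le_mul_of_nonneg_left ((abs_pow_sub_pow_le _ _ _).trans ?_) hy
    have h1 : max |rejectionProb μ (r - 1) d y| |limitRejection r (cdf μ y)| ^ (r - 1) ≤ 1 := by
      refine pow_le_one₀ (le_max_of_le_left (abs_nonneg _)) (max_le ?_ ?_)
      · rw [abs_of_nonneg (hT01 y).1]; exact (hT01 y).2
      · rw [abs_of_nonneg (hq01 y).1]; exact (hq01 y).2
    refine (mul_le_of_le_one_right (by positivity) h1).trans ?_
    rw [mul_comm, mul_div_assoc]
    refine mul_le_mul_of_nonneg_left ((rejectionProb_sandwich μ hr d y).2.2.trans ?_)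
      (Nat.cast_nonneg r)
    have h0 := cdf_nonneg μ y
    have h1 := cdf_le_one μ y
    gcongr
    exact mul_le_of_le_one_right (by positivity) (pow_le_one₀ (by linarith) (by linarith))

/-- For either parity both quantities lie in one interval of length equal to the error bound, with
the truncated value ∫ y T_d^r dμ as an endpoint. A triangle inequality would double the bound. -/
theorem abs_greedyContribution_sub_le [NullSingletonClass μ] {V : Type*} [Fintype V]
    {G : SimpleGraph V} [DecidableRel G.Adj] {g : ℕ} (hg : (g : ℕ∞) ≤ G.egirth)
    (hreg : G.IsRegularOfDegree r) (hr : 3 ≤ r) (hμ : Integrable id μ) (hnn : 0 ≤ᵐ[μ] id) {d : ℕ}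
    (hd0 : 1 ≤ d) (hd : 2 * d < g) (v : V) :
    |greedyContribution G μ v - ∫ y, y * limitRejection r (cdf μ y) ^ r ∂μ| ≤
      (∫ y, y ∂μ) * (r * ((r : ℝ) - 1) ^ d / (d + 1)!) := by
  obtain ⟨h1, h2⟩ := greedyContribution_sandwich μ hg hreg (by omega) hμ hnn d hd0 hd v
  obtain ⟨h3, h4, h5⟩ := integral_rejectionProb_sandwich μ hr hμ hnn d
  rw [abs_le] at h5 ⊢
  rcases Nat.even_or_odd d with he | ho
  · have := h1 he
    have := h3 he
    constructor <;> linarith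
  · have := h2 ho
    have := h4 ho
    constructor <;> linarith

theorem abs_expectedGreedyWeightPerNode_sub_le [NullSingletonClass μ] {V : Type*} [Fintype V]
    [Nonempty V] {G : SimpleGraph V} [DecidableRel G.Adj] {g : ℕ} (hg : (g : ℕ∞) ≤ G.egirth)
    (hreg : G.IsRegularOfDegree r) (hr : 3 ≤ r) (hμ : Integrable id μ) (hnn : 0 ≤ᵐ[μ] id) {d : ℕ}
    (hd0 : 1 ≤ d) (hd : 2 * d < g) :
    |expectedGreedyWeightPerNode G μ - ∫ y, y * limitRejection r (cdf μ y) ^ r ∂μ| ≤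
      (∫ y, y ∂μ) * (r * ((r : ℝ) - 1) ^ d / (d + 1)!) := by
  have hcard : (0 : ℝ) < Fintype.card V := by exact_mod_cast Fintype.card_pos
  rw [expectedGreedyWeightPerNode_eq G μ hμ, div_sub' hcard.ne', abs_div, abs_of_pos hcard,
    div_le_iff₀ hcard, ← nsmul_eq_mul, ← Finset.card_univ, ← Finset.sum_const,
    ← Finset.sum_sub_distrib, mul_comm _ (_ : ℝ), ← nsmul_eq_mul, ← Finset.sum_const]
  exact (Finset.abs_sum_le_sum_abs _ _).trans (Finset.sum_le_sum fun v _ =>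
    abs_greedyContribution_sub_le μ hg hreg hr hμ hnn hd0 hd v)

end limit

/-! ### Passage to the density and conclusion -/

open ProbabilityTheory in
theorem limitIntegrand_integrableOn_and_integral_eq (μ : Measure ℝ) {r : ℕ} {f : ℝ → ℝ} (hr : 3 ≤ r)
    (hf : Measurable f) (hf_nonneg : ∀ x, 0 ≤ f x)
    (hμf : μ = volume.withDensity fun x => ENNReal.ofReal (f x))
    (hμ : Integrable id μ) (hnn : 0 ≤ᵐ[μ] id) :
    IntegrableOn (limitIntegrand r (cdf μ) f) (Set.Ioi 0) volume ∧
      ∫ x in Set.Ioi 0, limitIntegrand r (cdf μ) f x =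
        ∫ y, y * limitRejection r (cdf μ y) ^ r ∂μ := by
  have hfm : Measurable fun x => (f x).toNNReal := hf.real_toNNReal
  have hμf' : μ = volume.withDensity fun x => ((f x).toNNReal : ENNReal) := hμf
  have hlim : limitIntegrand r (cdf μ) f =
      fun x => (f x).toNNReal • (x * limitRejection r (cdf μ x) ^ r) := by
    ext x
    rw [limitIntegrand, limitRejection_pow hr (cdf_le_one μ x), NNReal.smul_def, smul_eq_mul,
      Real.coe_toNNReal _ (hf_nonneg x)]
    ring
  have hqi := integrable_mul_pow_of_mem_Icc hμ (measurable_limitRejection_cdf μ)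
    (limitRejection_cdf_mem_Icc μ hr) r
  have hint : Integrable (limitIntegrand r (cdf μ) f) volume := by
    rw [hlim, ← integrable_withDensity_iff_integrable_smul hfm, ← hμf']
    exact hqi
  refine ⟨hint.integrableOn, ?_⟩
  have hval : ∫ x, limitIntegrand r (cdf μ) f x = ∫ y, y * limitRejection r (cdf μ y) ^ r ∂μ := by
    -- Hides the μ inside `cdf μ`, so that the density replaces only the measure of integration.
    generalize hh : (fun y => y * limitRejection r (cdf μ y) ^ r) = h at hlim ⊢
    have hlim2 : limitIntegrand r (cdf μ) f = fun x => (f x).toNNReal • h x := by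
      rw [hlim]; ext x; rw [← hh]
    rw [hlim2, hμf', integral_withDensity_eq_integral_smul hfm]
  rw [← hval]
  -- Off (0, ∞) the integrand vanishes almost everywhere: `f` is zero on the negative half-line up
  -- to a null set, and at 0 the factor x is zero.
  have hneg : ∀ᵐ x, ENNReal.ofReal (f x) ≠ 0 → 0 ≤ x := by
    have h1 : ∀ᵐ x ∂volume.withDensity fun x => ENNReal.ofReal (f x), 0 ≤ x := by
      rw [← hμf]; exact hnn
    rwa [ae_withDensity_iff hf.ennreal_ofReal] at h1
  refine setIntegral_eq_integral_of_ae_compl_eq_zero ?_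
  filter_upwards [hneg] with x hx hx0
  have hx0 : x ≤ 0 := not_lt.1 hx0
  rw [limitIntegrand]
  rcases hx0.lt_or_eq with hlt | rfl
  · have : f x = 0 := by
      by_contra hne
      have hpos : 0 < f x := lt_of_le_of_ne (hf_nonneg x) (Ne.symm hne)
      exact absurd (hx (by simpa using hpos)) (not_le.2 hlt)
    rw [this, mul_zero]
  · simp

theorem theorem1 (g r : ℕ) (hg : 4 ≤ g) (hr : 3 ≤ r)
    {Ω : Type v} [MeasurableSpace Ω] (P : Measure Ω) [IsProbabilityMeasure P]
    (W : Ω → ℝ) (hW : Measurable W) (hW_nonneg : ∀ᵐ ω ∂P, 0 ≤ W ω) (hW_int : Integrable W P)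
    (f : ℝ → ℝ) (hf : Measurable f) (hf_nonneg : ∀ x, 0 ≤ f x)
    (hWf : P.map W = volume.withDensity fun x => ENNReal.ofReal (f x))
    (F : ℝ → ℝ) (hF : ∀ x, F x = P.real {ω | W ω ≤ x}) :
    IntegrableOn (limitIntegrand r F f) (Set.Ioi 0) volume ∧
    (∀ G : RegularGraphOfGirth.{u} g r,
      Integrable (greedyWeightPerNode G.graph) (iidWeights G.V (P.map W))) ∧
    (((∫ x in Set.Ioi 0, limitIntegrand r F f x) - (∫ ω, W ω ∂P) * girthError g r : ℝ) : EReal)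
      ≤ (⨅ G : RegularGraphOfGirth.{u} g r,
          (expectedGreedyWeightPerNode G.graph (P.map W) : EReal)) ∧
    (⨅ G : RegularGraphOfGirth.{u} g r,
          (expectedGreedyWeightPerNode G.graph (P.map W) : EReal))
      ≤ (⨆ G : RegularGraphOfGirth.{u} g r,
          (expectedGreedyWeightPerNode G.graph (P.map W) : EReal)) ∧
    (⨆ G : RegularGraphOfGirth.{u} g r,
          (expectedGreedyWeightPerNode G.graph (P.map W) : EReal))
      ≤ (((∫ x in Set.Ioi 0, limitIntegrand r F f x)
            + (∫ ω, W ω ∂P) * girthError g r : ℝ) : EReal) := by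
  classical
  set μ := P.map W
  have hprob : IsProbabilityMeasure μ := Measure.isProbabilityMeasure_map hW.aemeasurable
  have hatoms : NullSingletonClass μ := by rw [hWf]; infer_instance
  have hint : Integrable id μ :=
    (integrable_map_measure measurable_id.aestronglyMeasurable hW.aemeasurable).2 hW_int
  have hnn : 0 ≤ᵐ[μ] id :=
    (ae_map_iff hW.aemeasurable (measurableSet_le measurable_const measurable_id)).2 hW_nonneg
  have hmean : ∫ ω, W ω ∂P = ∫ y, y ∂μ :=
    (integral_map hW.aemeasurable measurable_id.aestronglyMeasurable).symm
  have hFcdf : F = ProbabilityTheory.cdf μ := by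
    ext x
    rw [hF, ProbabilityTheory.cdf_eq_real, map_measureReal_apply hW measurableSet_Iic]
    rfl
  obtain ⟨hI, hIeq⟩ := limitIntegrand_integrableOn_and_integral_eq μ hr hf hf_nonneg hWf hint hnn
  rw [hFcdf]
  have key : ∀ G : RegularGraphOfGirth.{u} g r,
      |expectedGreedyWeightPerNode G.graph μ -
        ∫ x in Set.Ioi 0, limitIntegrand r (ProbabilityTheory.cdf μ) f x| ≤
          (∫ ω, W ω ∂P) * girthError g r := by
    intro G
    rw [hIeq, hmean]
    -- Here d = (g - 2) / 2: `4 ≤ g` gives 1 ≤ d, and 2d ≤ g - 2 < g.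
    exact abs_expectedGreedyWeightPerNode_sub_le μ G.girth_ge (by convert G.regular) hr hint hnn
      (by omega) (by omega)
  refine ⟨hI, fun G => integrable_greedyWeightPerNode G.graph μ hint, ?_, ?_, ?_⟩
  · refine le_iInf fun G => EReal.coe_le_coe_iff.2 ?_
    linarith [(abs_le.1 (key G)).1]
  · have := nonempty_regularGraphOfGirth.{u} g r
    exact iInf_le_iSup
  · refine iSup_le fun G => EReal.coe_le_coe_iff.2 ?_
    linarith [(abs_le.1 (key G)).2]
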